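/- Consider the linear network with $K$ transmitters and $K$ receivers in which transmitter $j$ can reach only receivers $j$ and $j+1$ (the last one only receiver $K$). In a block, each of these links is erased independently with probability $p\in[0,1]$; the coefficient of a link that is not erased is drawn afresh in each time slot from a continuous (atomless) probability law $\nu$ on $\mathbb C$ with $\int\log(1+|h|^2)\,d\nu<\infty$, and the receiver noise is complex Gaussian with unit variance. Each message $W_i$, intended for receiver $i$, is available at the transmitters of its transmit set $\mathcal T_i\subseteq\{1,\dots,K\}$. An orthogonal TDMA scheme for a given erasure realization is a schedule of finitely many time slots, repeated periodically, with transmit powers whose time average at each transmitter is at most $P$; in each slot, every active message is sent by one transmitter that knows it, over a link that is not erased, and the receivers of active messages hear no transmission of another active message. A message has rate $\int\log(1+|h|^2Q)\,d\nu(h)$ in a slot in which it is sent with power $Q$, and rate $0$ in a slot in which it is not active; $C_{\mathrm{TDMA}}(P)$ is the supremum over all such schemes of the time-averaged sum rate. The TDMA DoF of the realization is $\limsup_{P\to\infty}C_{\mathrm{TDMA}}(P)/\log P$, the average DoF of an assignment $(\mathcal T_i)$ is the expectation of the TDMA DoF over the erasures, and $\eta_p^{(TDMA)}(K,1)$ is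 the maximum of the average DoF over all assignments with $|\mathcal T_i|\le1$ for all $i$. Let $$\tau_p^{(1)}=\tfrac12\Big(1-p+(1-p)\big(1-(1-p)^2\big)^2\Big)+\sum_{i=1}^\infty\tfrac12\big(1-(1-p)^2\big)^2(1-p)^{4i+1},$$ $$\tau_p^{(2)}=\tfrac23(1-p)+\tfrac13p(1-p)\big(1-(1-p)^2\big),$$ $$\tau_p^{(3)}=\tfrac12(1-p)+\tfrac14(1-p)\big(1-(1-p)^2\big)\big(1+p+(1-p)^3\big).$$ Then for every $p\in[0,1]$ the limit $\tau_p^{(TDMA)}=\lim_{K\to\infty}\eta_p^{(TDMA)}(K,1)/K$ exists and $$\tau_p^{(TDMA)}=\max\{\tau_p^{(1)},\tau_p^{(2)},\tau_p^{(3)}\}.$$ Call a single-transmitter assignment irreducible if each $\mathcal T_i$ is one of $\{i-1\}$, $\{i\}$ (so $\mathcal T_1=\{1\}$). For every sequence of irreducible assignments, one for each $K$, the $\limsup$ over $K$ of the average DoF divided by $K$ is at most a convex combination (which may depend on $p$) of $\tau_p^{(1)},\tau_p^{(2)},\tau_p^{(3)}$. In particular, consider the irreducible assignments defined by a string of length $m$: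 for each $K$, the string, repeated $\lfloor K/m\rfloor$ times and followed by ones, lists the numbers of messages carried by the transmitters $1,\dots,K$. For the strings below, the average DoF divided by $K$ converges as $K\to\infty$, and the limit * equals $\tau_p^{(1)}$ for the string $(1)$; * for the strings $(2,1,\dots,1,0)$ and $(1,\dots,1,2,0)$ with $n\ge0$ ones, is at most $\frac{n-1}{n+2}\tau_p^{(1)}+\frac3{n+2}\tau_p^{(2)}$ if $n$ is odd, and at most $\frac n{n+2}\tau_p^{(1)}+\frac2{n+2}\tau_p^{(2)}$ if $n$ is even; * for every string $(1,\dots,1,2,1,\dots,1,0)$ with at least one $1$ on each side of the $2$, is at most a convex combination (which may depend on $p$) of $\tau_p^{(1)},\tau_p^{(2)},\tau_p^{(3)}$. -/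

import Mathlib

open Filter Topology MeasureTheory

noncomputable section

namespace WynerTDMA

/-- The links of the `K`-user linear network, as pairs (receiver, transmitter): transmitter `j` can
only reach receivers `j` and `j + 1` (and the last transmitter only its own receiver). -/
abbrev Link (K : ℕ) : Type :=
  {l : Fin K × Fin K // l.1 = l.2 ∨ (l.1 : ℕ) = (l.2 : ℕ) + 1}

/-- A network realization: `ω l = true` iff the link `l` is not erased in the block. -/
abbrev Topology (K : ℕ) : Type := Link K → Bool

/-- The probability of a network realization: each link is erased independently with
probability `p`. -/
def Topology.prob {K : ℕ} (p : ℝ) (ω : Topology K) : ℝ :=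
  ∏ l : Link K, if ω l = true then 1 - p else p

/-- Transmitter `j` is connected to receiver `i` in the realization `ω`, that is, the channel
coefficient from `j` to `i` is not identically zero. -/
def Connected {K : ℕ} (ω : Topology K) (i j : Fin K) : Prop :=
  ∃ h : i = j ∨ (i : ℕ) = (j : ℕ) + 1, ω ⟨(i, j), h⟩ = true

/-- A message assignment: `T i` is the transmit set of the `i`-th message. -/
abbrev Assignment (K : ℕ) : Type := Fin K → Finset (Fin K)

/-- An orthogonal TDMA scheme with average transmit power at most `P`, over a frame of
`slots` time slots that is repeated periodically.  In slot `t`, the pair `(i, j) ∈ active t` means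
that transmitter `j` sends message `i` with power `power t (i, j)`.  A message is only sent by a
transmitter that knows it and is connected to its receiver, and no receiver of an active message
hears the transmission of another active message (in particular the active messages and the
active transmitters of a slot are pairwise distinct). -/
structure Scheme {K : ℕ} (ω : Topology K) (T : Assignment K) (P : ℝ) where
  slots : ℕ
  slots_pos : 0 < slots
  active : Fin slots → Finset (Fin K × Fin K)
  known : ∀ t, ∀ a ∈ active t, a.2 ∈ T a.1
  linked : ∀ t, ∀ a ∈ active t, Connected ω a.1 a.2
  orthogonal : ∀ t, ∀ a ∈ active t, ∀ b ∈ active t, a ≠ b → ¬ Connected ω a.1 b.2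
  power : Fin slots → Fin K × Fin K → ℝ
  power_nonneg : ∀ t a, 0 ≤ power t a
  power_le : ∀ j : Fin K,
    (∑ t, ∑ a ∈ (active t).filter (fun a => a.2 = j), power t a) / (slots : ℝ) ≤ P

/-- The sum of the rates of the messages: in each slot where it is active, a message is sent over an
interference-free complex Gaussian channel with unit noise variance, whose coefficient is drawn
afresh in every slot from the fading law `ν`. -/
def Scheme.sumRate {K : ℕ} {ω : Topology K} {T : Assignment K} {P : ℝ} (ν : Measure ℂ)
    (s : Scheme ω T P) : ℝ :=
  (∑ t, ∑ a ∈ s.active t, ∫ h, Real.log (1 + ‖h‖ ^ 2 * s.power t a) ∂ν) / (s.slots : ℝ)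

/-- The sum capacity of a network realization under the restriction to orthogonal TDMA schemes. -/
def sumCapacity {K : ℕ} (ν : Measure ℂ) (ω : Topology K) (T : Assignment K) (P : ℝ) : ℝ :=
  sSup (Set.range fun s : Scheme ω T P => s.sumRate ν)

/-- The total number of degrees of freedom of a network realization under orthogonal TDMA. -/
def dof {K : ℕ} (ν : Measure ℂ) (ω : Topology K) (T : Assignment K) : ℝ :=
  limsup (fun P : ℝ => sumCapacity ν ω T P / Real.log P) atTop

/-- The degrees of freedom of an assignment, averaged over the link erasures. -/
def avgDof {K : ℕ} (ν : Measure ℂ) (p : ℝ) (T : Assignment K) : ℝ :=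
  ∑ ω : Topology K, ω.prob p * dof ν ω T

/-- The best average number of degrees of freedom of the `K`-user network under orthogonal TDMA,
over all assignments with transmit sets of size at most `M`. -/
def bestDof (ν : Measure ℂ) (p : ℝ) (K M : ℕ) : ℝ :=
  ⨆ T : {T : Assignment K // ∀ i, (T i).card ≤ M}, avgDof ν p T.1

/-- An irreducible single-transmitter assignment: each message is assigned to exactly one of the
(at most two) transmitters that can be connected to its receiver. -/
def Irreducible {K : ℕ} (T : Assignment K) : Prop :=
  ∀ i, ∃ j : Fin K, T i = {j} ∧ (i = j ∨ (i : ℕ) = (j : ℕ) + 1)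

/-- The number of messages available at transmitter `j`. -/
def load {K : ℕ} (T : Assignment K) (j : Fin K) : ℕ :=
  (Finset.univ.filter fun i => j ∈ T i).card

/-- The load sequence of the `K`-user network that a string `S` defines: `S` is repeated as
often as it fits, and the remaining transmitters carry one message each. -/
def stringLoad (S : List ℕ) (K : ℕ) (j : Fin K) : ℕ :=
  if (j : ℕ) < S.length * (K / S.length) then S.getD ((j : ℕ) % S.length) 1 else 1

/-- The assignment strategy `T` (one irreducible assignment for each network size) is the one
defined by the string `S`. -/
def DefinedBy (T : ∀ K : ℕ, Assignment K) (S : List ℕ) : Prop :=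
  ∀ K, Irreducible (T K) ∧ load (T K) = stringLoad S K

/-- The string `(1, …, 1, 2, 1, …, 1, 0)` with `a` ones before and `b` ones after the `2`. -/
def twoString (a b : ℕ) : List ℕ :=
  List.replicate a 1 ++ [2] ++ List.replicate b 1 ++ [0]

/-- The value for the string `(1)`. -/
def tau1 (p : ℝ) : ℝ :=
  1 / 2 * ((1 - p) + (1 - p) * (1 - (1 - p) ^ 2) ^ 2)
    + ∑' i : ℕ, 1 / 2 * (1 - (1 - p) ^ 2) ^ 2 * (1 - p) ^ (4 * (i + 1) + 1)

/-- The value for the string `(2, 1, 0)`. -/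
def tau2 (p : ℝ) : ℝ :=
  2 / 3 * (1 - p) + 1 / 3 * p * (1 - p) * (1 - (1 - p) ^ 2)

/-- The value for the string `(1, 2, 1, 0)`. -/
def tau3 (p : ℝ) : ℝ :=
  1 / 2 * (1 - p)
    + 1 / 4 * (1 - p) * (1 - (1 - p) ^ 2) * (1 + p + (1 - p) ^ 3)

/-- `x` is at most some convex combination of the three values at `p`. -/
def BoundedByConvexComb (p x : ℝ) : Prop :=
  ∃ w₁ w₂ w₃ : ℝ, 0 ≤ w₁ ∧ 0 ≤ w₂ ∧ 0 ≤ w₃ ∧ w₁ + w₂ + w₃ = 1 ∧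
    x ≤ w₁ * tau1 p + w₂ * tau2 p + w₃ * tau3 p

end WynerTDMA

end

/-! At high power every interference-free transmission contributes one degree of freedom, and power
can only be averaged over slots. The TDMA DoF of a realization is therefore the largest number of
simultaneously feasible transmissions (`dof_eq_maxActive`).

An irreducible assignment is a Boolean pattern `x`: message `i` is sent by transmitter `i - 1` if `x
i`, else by `i`. Only consecutive messages can collide (`interference_iff`), so the conflict graph
lies on a path and left-to-right greedy activation is optimal (`maxActive_eq_sum_greedy`). With `q =
1 - p`, independence of the links turns the activation probabilities into the recursion `P (n+1) = q
* (1 - c * P n)`, where `c` is `q` if `x` does not change, `1` at a change from false to true, and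
`0` at a change from true to false (`erasureMean_greedy`).

The value `c = 0` makes the recursion start afresh, so the pattern splits into independent segments
of `a` falses followed by `b` trues. A segment is worth `(a + b) * chainRate q` plus a multiple of
`segmentGain q a b`. With `u n = 1 - (-q^2)^n`, the gain is governed by `q^2 - (u a - q) * (u b -
q)`, and over `n ≥ 1` the extremes of `u` are `u 1` and `u 2`. Hence the best value per message
comes from `(1, 2)`, from `(2, 2)`, or from never switching (`segmentValue_le`); these are `tau2`,
`tau3` and `tau1`. An unfinished last segment costs only a bounded error, and periodic patterns
attain the three values. -/

noncomputable section

namespace WynerTDMA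

/-! ### Degrees of freedom of a realization -/

/-- A set of simultaneously feasible transmissions (receiver, transmitter). -/
structure Feasible {K : ℕ} (ω : Topology K) (T : Assignment K)
    (A : Finset (Fin K × Fin K)) : Prop where
  known : ∀ a ∈ A, a.2 ∈ T a.1
  linked : ∀ a ∈ A, Connected ω a.1 a.2
  orthogonal : ∀ a ∈ A, ∀ b ∈ A, a ≠ b → ¬ Connected ω a.1 b.2

open Classical in
/-- The largest number of simultaneously feasible transmissions. -/
def maxActive {K : ℕ} (ω : Topology K) (T : Assignment K) : ℕ :=
  (Finset.univ.filter (Feasible ω T)).sup Finset.card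

lemma Feasible.card_le {K : ℕ} {ω : Topology K} {T : Assignment K}
    {A : Finset (Fin K × Fin K)} (h : Feasible ω T A) : A.card ≤ maxActive ω T := by
  classical
  exact Finset.le_sup (f := Finset.card) (by simpa using h)

lemma maxActive_le {K : ℕ} {ω : Topology K} {T : Assignment K} {n : ℕ}
    (h : ∀ A, Feasible ω T A → A.card ≤ n) : maxActive ω T ≤ n := by
  classical
  exact Finset.sup_le fun A hA => h A (by simpa using hA)

lemma exists_feasible_card_eq {K : ℕ} (ω : Topology K) (T : Assignment K) :
    ∃ A, Feasible ω T A ∧ A.card = maxActive ω T := by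
  classical
  have hne : (Finset.univ.filter (Feasible ω T)).Nonempty :=
    ⟨∅, by simpa using ⟨by simp, by simp, by simp⟩⟩
  obtain ⟨A, hA, h⟩ := Finset.exists_mem_eq_sup _ hne Finset.card
  exact ⟨A, by simpa using hA, h.symm⟩

lemma log_one_add_mul_le {x Q : ℝ} (hx : 0 ≤ x) (hQ : 0 ≤ Q) :
    Real.log (1 + x * Q) ≤ Real.log (1 + x) + Real.log (1 + Q) := by
  rw [← Real.log_mul (by positivity) (by positivity)]
  apply Real.log_le_log (by positivity)
  nlinarith [mul_nonneg hx hQ]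

/-- Power is bounded only on average, so a single slot may use more than `P`. Concavity charges the
excess linearly, which can then be averaged over the frame. -/
lemma log_one_add_le_tangent {P Q : ℝ} (hP : 0 ≤ P) (hQ : 0 ≤ Q) :
    Real.log (1 + Q) ≤ Real.log (1 + P) + Q / (1 + P) := by
  have h := Real.log_le_sub_one_of_pos (x := (1 + Q) / (1 + P)) (by positivity)
  rw [Real.log_div (by positivity) (by positivity), add_div] at h
  have : 1 / (1 + P) ≤ 1 := by
    rw [div_le_one (by positivity)]; linarith
  linarith

lemma integral_rate_le {ν : Measure ℂ} [IsProbabilityMeasure ν]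
    (hν : Integrable (fun h : ℂ => Real.log (1 + ‖h‖ ^ 2)) ν) {Q : ℝ} (hQ : 0 ≤ Q) :
    ∫ h, Real.log (1 + ‖h‖ ^ 2 * Q) ∂ν
      ≤ ∫ h, Real.log (1 + ‖h‖ ^ 2) ∂ν + Real.log (1 + Q) := by
  have h1 : ∫ h, Real.log (1 + ‖h‖ ^ 2 * Q) ∂ν
      ≤ ∫ h, (Real.log (1 + ‖h‖ ^ 2) + Real.log (1 + Q)) ∂ν := by
    apply integral_mono_of_nonneg
    · filter_upwards with h
      exact Real.log_nonneg (by nlinarith [mul_nonneg (sq_nonneg ‖h‖) hQ])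
    · exact hν.add (integrable_const _)
    · filter_upwards with h
      exact log_one_add_mul_le (by positivity) hQ
  rwa [integral_add hν (integrable_const _), integral_const, probReal_univ, one_smul] at h1

lemma Scheme.feasible {K : ℕ} {ω : Topology K} {T : Assignment K} {P : ℝ}
    (s : Scheme ω T P) (t : Fin s.slots) : Feasible ω T (s.active t) :=
  ⟨s.known t, s.linked t, s.orthogonal t⟩

lemma Scheme.sumRate_le {K : ℕ} {ω : Topology K} {T : Assignment K} {P : ℝ}
    {ν : Measure ℂ} [IsProbabilityMeasure ν]
    (hν : Integrable (fun h : ℂ => Real.log (1 + ‖h‖ ^ 2)) ν) (hP : 0 ≤ P)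
    (s : Scheme ω T P) :
    s.sumRate ν ≤ maxActive ω T * (∫ h, Real.log (1 + ‖h‖ ^ 2) ∂ν + Real.log (1 + P)) + K := by
  set C := ∫ h, Real.log (1 + ‖h‖ ^ 2) ∂ν with hC
  have hC0 : 0 ≤ C := integral_nonneg fun h =>
    Real.log_nonneg (by nlinarith [sq_nonneg ‖h‖])
  have hL0 : 0 ≤ Real.log (1 + P) := Real.log_nonneg (by linarith)
  have hs : (0 : ℝ) < s.slots := by exact_mod_cast s.slots_pos
  unfold Scheme.sumRate
  rw [div_le_iff₀ hs]
  have hterm : ∀ t, ∀ a ∈ s.active t, ∫ h, Real.log (1 + ‖h‖ ^ 2 * s.power t a) ∂ν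
      ≤ (C + Real.log (1 + P)) + s.power t a / (1 + P) := fun t a _ => by
    have h1 := integral_rate_le hν (s.power_nonneg t a)
    have h2 := log_one_add_le_tangent hP (s.power_nonneg t a)
    linarith
  -- Grouping by transmitter lets the power constraint bound the linear terms; after division by `1
  -- + P` they cost at most `K` per slot, independently of `P`.
  have hpow : ∑ t, ∑ a ∈ s.active t, s.power t a ≤ K * (P * s.slots) := by
    have h1 : ∑ t, ∑ a ∈ s.active t, s.power t a
        = ∑ j : Fin K, ∑ t, ∑ a ∈ (s.active t).filter (fun a => a.2 = j), s.power t a := by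
      rw [Finset.sum_comm]
      refine Finset.sum_congr rfl fun t _ => ?_
      rw [Finset.sum_fiberwise]
    rw [h1]
    calc _ ≤ ∑ _j : Fin K, P * s.slots := Finset.sum_le_sum fun j _ => by
            have := s.power_le j
            rwa [div_le_iff₀ hs] at this
      _ = K * (P * s.slots) := by simp
  calc ∑ t, ∑ a ∈ s.active t, ∫ h, Real.log (1 + ‖h‖ ^ 2 * s.power t a) ∂ν
      ≤ ∑ t, ∑ a ∈ s.active t, ((C + Real.log (1 + P)) + s.power t a / (1 + P)) :=
        Finset.sum_le_sum fun t _ => Finset.sum_le_sum (hterm t)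
    _ = ∑ t, ((s.active t).card * (C + Real.log (1 + P)))
          + (∑ t, ∑ a ∈ s.active t, s.power t a) / (1 + P) := by
        simp only [Finset.sum_add_distrib, Finset.sum_const, nsmul_eq_mul, Finset.sum_div, mul_add]
    _ ≤ ∑ _t : Fin s.slots, (maxActive ω T * (C + Real.log (1 + P)))
          + K * s.slots := by
        apply add_le_add
        · refine Finset.sum_le_sum fun t _ => ?_
          have : ((s.active t).card : ℝ) ≤ maxActive ω T := by
            exact_mod_cast (s.feasible t).card_le
          exact mul_le_mul_of_nonneg_right this (by linarith)
        · rw [div_le_iff₀ (by linarith)]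
          have : 0 ≤ (K : ℝ) * s.slots := by positivity
          nlinarith
    _ = _ := by
        simp only [Finset.sum_const, Finset.card_univ, Fintype.card_fin, nsmul_eq_mul]
        ring

/-- The one-slot scheme in which all transmissions of a feasible set are sent with power `P`. -/
def Feasible.scheme {K : ℕ} {ω : Topology K} {T : Assignment K}
    {A : Finset (Fin K × Fin K)} (h : Feasible ω T A) {P : ℝ} (hP : 0 ≤ P) : Scheme ω T P where
  slots := 1
  slots_pos := one_pos
  active _ := A
  known _ := h.known
  linked _ := h.linked
  orthogonal _ := h.orthogonal
  power _ _ := P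
  power_nonneg _ _ := hP
  power_le j := by
    -- Two active messages with the same transmitter would collide, so each transmitter spends at
    -- most `P`.
    have hc : (A.filter (fun a => a.2 = j)).card ≤ 1 := by
      refine Finset.card_le_one.2 fun a ha b hb => ?_
      rw [Finset.mem_filter] at ha hb
      by_contra hab
      refine h.orthogonal a ha.1 b hb.1 hab ?_
      rw [hb.2, ← ha.2]
      exact h.linked a ha.1
    have hc' : ((A.filter (fun a => a.2 = j)).card : ℝ) ≤ 1 := by exact_mod_cast hc
    simpa using mul_le_of_le_one_left hP hc'

lemma sumCapacity_le {K : ℕ} (ω : Topology K) (T : Assignment K) {P : ℝ}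
    {ν : Measure ℂ} [IsProbabilityMeasure ν]
    (hν : Integrable (fun h : ℂ => Real.log (1 + ‖h‖ ^ 2)) ν) (hP : 0 ≤ P) :
    sumCapacity ν ω T P
      ≤ maxActive ω T * (∫ h, Real.log (1 + ‖h‖ ^ 2) ∂ν + Real.log (1 + P)) + K := by
  obtain ⟨A, hA, -⟩ := exists_feasible_card_eq ω T
  refine csSup_le ⟨_, hA.scheme hP, rfl⟩ ?_
  rintro _ ⟨s, rfl⟩
  exact s.sumRate_le hν hP

lemma le_sumCapacity {K : ℕ} (ω : Topology K) (T : Assignment K) {P : ℝ}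
    {ν : Measure ℂ} [IsProbabilityMeasure ν]
    (hν : Integrable (fun h : ℂ => Real.log (1 + ‖h‖ ^ 2)) ν) (hP : 0 ≤ P) :
    maxActive ω T * ∫ h, Real.log (1 + ‖h‖ ^ 2 * P) ∂ν ≤ sumCapacity ν ω T P := by
  obtain ⟨A, hA, hc⟩ := exists_feasible_card_eq ω T
  refine le_csSup
    ⟨maxActive ω T * (∫ h, Real.log (1 + ‖h‖ ^ 2) ∂ν + Real.log (1 + P)) + K, ?_⟩
    ⟨hA.scheme hP, ?_⟩
  · rintro _ ⟨s, rfl⟩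
    exact s.sumRate_le hν hP
  · change (∑ _t : Fin 1, ∑ _a ∈ A, ∫ h, Real.log (1 + ‖h‖ ^ 2 * P) ∂ν) / ((1 : ℕ) : ℝ) = _
    simp [hc]

lemma tendsto_log_one_add_mul_div_log {c : ℝ} (hc : 0 < c) :
    Tendsto (fun P : ℝ => Real.log (1 + c * P) / Real.log P) atTop (𝓝 1) := by
  have h1 : Tendsto (fun P : ℝ => Real.log (P⁻¹ + c)) atTop (𝓝 (Real.log c)) := by
    have : Tendsto (fun P : ℝ => P⁻¹ + c) atTop (𝓝 (0 + c)) :=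
      tendsto_inv_atTop_zero.add tendsto_const_nhds
    rw [zero_add] at this
    exact this.log hc.ne'
  have h2 := (tendsto_const_nhds (x := (1 : ℝ))).add (h1.div_atTop Real.tendsto_log_atTop)
  rw [add_zero] at h2
  refine h2.congr' ?_
  filter_upwards [eventually_gt_atTop 1] with P hP
  have hlog : Real.log P ≠ 0 := (Real.log_pos hP).ne'
  have hP0 : 0 < P := by linarith
  have : 1 + c * P = P * (P⁻¹ + c) := by field_simp
  rw [this, Real.log_mul hP0.ne' (by positivity), add_div, div_self hlog]

lemma tendsto_integral_rate_div_log {ν : Measure ℂ} [IsProbabilityMeasure ν]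
    [NullSingletonClass ν] (hν : Integrable (fun h : ℂ => Real.log (1 + ‖h‖ ^ 2)) ν) :
    Tendsto (fun P : ℝ => (∫ h, Real.log (1 + ‖h‖ ^ 2 * P) ∂ν) / Real.log P) atTop (𝓝 1) := by
  have key : Tendsto (fun P : ℝ => ∫ h, Real.log (1 + ‖h‖ ^ 2 * P) / Real.log P ∂ν) atTop
      (𝓝 (∫ _, (1 : ℝ) ∂ν)) := by
    refine tendsto_integral_filter_of_dominated_convergence
      -- For `P ≥ 3` one has `log P ≥ 1` and `log (1 + P) ≤ 2 log P`, which gives this dominating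
      -- function.
      (fun h => Real.log (1 + ‖h‖ ^ 2) + 2) ?_ ?_ (hν.add (integrable_const _)) ?_
    · filter_upwards with P
      exact (Measurable.aestronglyMeasurable (by fun_prop))
    · filter_upwards [eventually_ge_atTop 3] with P hP
      filter_upwards with h
      have hx : 0 ≤ ‖h‖ ^ 2 := by positivity
      have hlog : 1 ≤ Real.log P := by
        rw [Real.le_log_iff_exp_le (by linarith)]
        linarith [Real.exp_one_lt_d9]
      have h0 : 0 ≤ Real.log (1 + ‖h‖ ^ 2) := Real.log_nonneg (by linarith)
      have h1 : 0 ≤ Real.log (1 + ‖h‖ ^ 2 * P) :=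
        Real.log_nonneg (by nlinarith)
      have h2 : Real.log (1 + P) ≤ 2 * Real.log P := by
        rw [← Real.log_rpow (by linarith)]
        apply Real.log_le_log (by linarith)
        norm_num
        nlinarith
      have h3 := log_one_add_mul_le hx (show 0 ≤ P by linarith)
      rw [Real.norm_of_nonneg (by positivity), div_le_iff₀ (by linarith)]
      nlinarith
    -- Atomlessness enters here: the pointwise limit is `1` only for `h ≠ 0`.
    · have h0 : ∀ᵐ h ∂ν, h ≠ (0 : ℂ) := by
        rw [ae_iff]
        simp
      filter_upwards [h0] with h hh
      exact tendsto_log_one_add_mul_div_log (by positivity)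
  simpa [integral_div] using key

lemma dof_eq_maxActive {ν : Measure ℂ} [IsProbabilityMeasure ν]
    [NullSingletonClass ν] (hν : Integrable (fun h : ℂ => Real.log (1 + ‖h‖ ^ 2)) ν)
    {K : ℕ} (ω : Topology K) (T : Assignment K) : dof ν ω T = maxActive ω T := by
  refine Tendsto.limsup_eq ?_
  set C := ∫ h, Real.log (1 + ‖h‖ ^ 2) ∂ν with hC
  have hlow := (tendsto_integral_rate_div_log hν).const_mul (maxActive ω T : ℝ)
  have hlog1 := tendsto_log_one_add_mul_div_log one_pos
  have hcst : Tendsto (fun P : ℝ => (maxActive ω T * C + K) / Real.log P) atTop (𝓝 0) :=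
    tendsto_const_nhds.div_atTop Real.tendsto_log_atTop
  have hup := (hlog1.const_mul (maxActive ω T : ℝ)).add hcst
  rw [mul_one] at hlow
  rw [mul_one, add_zero] at hup
  refine tendsto_of_tendsto_of_tendsto_of_le_of_le' hlow hup ?_ ?_
  · filter_upwards [eventually_gt_atTop 1] with P hP
    rw [← mul_div_assoc]
    have := Real.log_pos hP
    gcongr
    exact le_sumCapacity ω T hν (by linarith)
  · filter_upwards [eventually_gt_atTop 1] with P hP
    rw [← mul_div_assoc, ← add_div]
    have := Real.log_pos hP
    gcongr
    refine (sumCapacity_le ω T hν (by linarith)).trans (le_of_eq ?_)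
    rw [one_mul]
    ring

/-! ### The success probabilities of the greedy schedule -/

/-- The probability that two neighbouring messages collide, given that both links are on and that
the first is scheduled. -/
def conflictProb (q : ℝ) : Bool → Bool → ℝ
  | false, false => q
  | true, true => q
  | false, true => 1
  | true, false => 0

/-- The probability that the greedy schedule activates message `n`. -/
def greedyProb (q : ℝ) (x : ℕ → Bool) : ℕ → ℝ
  | 0 => q
  | n + 1 => q * (1 - conflictProb q (x n) (x (n + 1)) * greedyProb q x n)

lemma greedyProb_mem {q : ℝ} (h0 : 0 ≤ q) (h1 : q ≤ 1) (x : ℕ → Bool) (n : ℕ) :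
    0 ≤ greedyProb q x n ∧ greedyProb q x n ≤ 1 := by
  induction n with
  | zero => exact ⟨h0, h1⟩
  | succ n ih =>
    have hc : 0 ≤ conflictProb q (x n) (x (n + 1)) ∧ conflictProb q (x n) (x (n + 1)) ≤ 1 := by
      cases x n <;> cases x (n + 1) <;> simp [conflictProb, h0, h1]
    have h2 := mul_nonneg hc.1 ih.1
    have h3 := mul_le_one₀ hc.2 ih.1 ih.2
    simp only [greedyProb]
    constructor
    · exact mul_nonneg h0 (by linarith)
    · exact mul_le_one₀ h1 (by linarith) (by linarith)

/-! ### Closed forms along a segment -/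

/-- The limit per message of a segment in which all messages use their own transmitter. -/
def chainRate (q : ℝ) : ℝ := q / (1 + q ^ 2)

/-- The alternating geometric sum `1 - q² + q⁴ - …` with `n` terms. -/
def altSum (q : ℝ) (n : ℕ) : ℝ := (1 - (-q ^ 2) ^ n) / (1 + q ^ 2)

/-- The deviation of a segment from the chain value, in units of `chainRate q * q`. -/
def segmentGain (q : ℝ) (a b : ℕ) : ℝ :=
  q * altSum q a + q * altSum q b - (1 + q ^ 2) * altSum q a * altSum q b

/-- The average number of active messages in a segment of `a` messages that use their own
transmitter, followed by `b` messages that use the previous transmitter. -/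
def segmentValue (q : ℝ) (a b : ℕ) : ℝ :=
  (a + b) * chainRate q + chainRate q * q * segmentGain q a b

/-- The activation probability of the last message of a segment. -/
def segmentLast (q : ℝ) (a : ℕ) : ℕ → ℝ
  | 0 => chainRate q * (1 - (-q ^ 2) ^ a)
  | b + 1 => chainRate q * (1 - q * (1 - q - (-q ^ 2) ^ a) * (-q ^ 2) ^ b)

lemma one_add_sq_pos (q : ℝ) : 0 < 1 + q ^ 2 := by positivity

/-- Together with the next three lemmas, this says that the closed form satisfies the greedy
recursion: conflict probability `q` inside each block and `1` at the switch. The fixed point of `y =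
q * (1 - q * y)` is `chainRate q`, and deviations from it shrink by `-q^2` per step. -/
lemma segmentLast_one_zero (q : ℝ) : segmentLast q 1 0 = q := by
  have := (one_add_sq_pos q).ne'
  simp only [segmentLast, chainRate]
  field_simp
  ring

lemma segmentLast_succ_zero (q : ℝ) (a : ℕ) :
    segmentLast q (a + 1) 0 = q * (1 - q * segmentLast q a 0) := by
  have := (one_add_sq_pos q).ne'
  simp only [segmentLast, chainRate, pow_succ _ a]
  field_simp
  ring

lemma segmentLast_one (q : ℝ) (a : ℕ) :
    segmentLast q a 1 = q * (1 - 1 * segmentLast q a 0) := by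
  have := (one_add_sq_pos q).ne'
  simp only [segmentLast, chainRate]
  field_simp
  ring

lemma segmentLast_succ_succ (q : ℝ) (a b : ℕ) :
    segmentLast q a (b + 2) = q * (1 - q * segmentLast q a (b + 1)) := by
  have := (one_add_sq_pos q).ne'
  simp only [segmentLast, chainRate, pow_succ _ b]
  field_simp
  ring

lemma segmentValue_zero (q : ℝ) : segmentValue q 0 0 = 0 := by
  simp [segmentValue, segmentGain, altSum]

lemma segmentValue_succ_zero (q : ℝ) (a : ℕ) :
    segmentValue q (a + 1) 0 = segmentValue q a 0 + segmentLast q (a + 1) 0 := by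
  have := (one_add_sq_pos q).ne'
  simp only [segmentLast, chainRate, segmentValue, segmentGain, altSum, pow_succ _ a]
  push_cast
  field_simp
  ring

lemma segmentValue_succ (q : ℝ) (a b : ℕ) :
    segmentValue q a (b + 1) = segmentValue q a b + segmentLast q a (b + 1) := by
  have := (one_add_sq_pos q).ne'
  simp only [segmentLast, chainRate, segmentValue, segmentGain, altSum, pow_succ _ b]
  push_cast
  field_simp
  ring

lemma segmentGain_comm (q : ℝ) (a b : ℕ) : segmentGain q a b = segmentGain q b a := by
  simp only [segmentGain]; ring

/-- A segment is a path whose vertices and edges are independently on with probability `q`, except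
for one certain edge at the switch; reading it backwards exchanges `a` and `b`. -/
lemma segmentValue_comm (q : ℝ) (a b : ℕ) : segmentValue q a b = segmentValue q b a := by
  simp only [segmentValue, segmentGain_comm q a b]; ring

/-- In this factored form, `a` and `b` enter through one factor each, so maximizing the gain means
minimizing a product. -/
lemma one_add_sq_mul_segmentGain (q : ℝ) (a b : ℕ) :
    (1 + q ^ 2) * segmentGain q a b
      = q ^ 2 - ((1 - (-q ^ 2) ^ a) - q) * ((1 - (-q ^ 2) ^ b) - q) := by
  have := (one_add_sq_pos q).ne'
  simp only [segmentGain, altSum]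
  field_simp
  ring

/-! ### Extremal segment lengths -/

/-- The powers alternate in sign and decrease in modulus, so the extremes are at `n = 1` and `n =
2`. -/
lemma neg_sq_pow_bounds {q : ℝ} (h0 : 0 ≤ q) (h1 : q ≤ 1) {n : ℕ} (hn : 1 ≤ n) :
    -q ^ 2 ≤ (-q ^ 2) ^ n ∧ (-q ^ 2) ^ n ≤ q ^ 4 := by
  have hq : q ^ 2 ≤ 1 := by nlinarith
  have e : ∀ k, (-q ^ 2) ^ k = (-1) ^ k * (q ^ 2) ^ k := fun k => by
    rw [← mul_pow]; ring
  rcases Nat.even_or_odd n with h | h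
  · rw [e, h.neg_one_pow, one_mul]
    have h2 : 2 ≤ n := by
      obtain ⟨k, rfl⟩ := h; omega
    have := pow_le_pow_of_le_one (sq_nonneg q) hq h2
    constructor
    · have : 0 ≤ (q ^ 2) ^ n := by positivity
      nlinarith [sq_nonneg q]
    · calc _ ≤ _ := this
        _ = q ^ 4 := by ring
  · rw [e, h.neg_one_pow, neg_one_mul]
    have := pow_le_pow_of_le_one (sq_nonneg q) hq hn
    rw [pow_one] at this
    constructor
    · linarith
    · have : 0 ≤ (q ^ 2) ^ n := by positivity
      have : 0 ≤ q ^ 4 := by positivity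
      linarith

lemma chainRate_nonneg {q : ℝ} (h0 : 0 ≤ q) : 0 ≤ chainRate q :=
  div_nonneg h0 (one_add_sq_pos q).le

lemma chainRate_le_one (q : ℝ) : chainRate q ≤ 1 := by
  rw [chainRate, div_le_one (one_add_sq_pos q)]
  nlinarith [sq_nonneg (q - 1), sq_nonneg q]

lemma altSum_mem {q : ℝ} (h0 : 0 ≤ q) (h1 : q ≤ 1) (n : ℕ) :
    0 ≤ altSum q n ∧ altSum q n ≤ 1 := by
  have hpos := one_add_sq_pos q
  rcases Nat.eq_zero_or_pos n with rfl | hn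
  · simp [altSum]
  · have h := neg_sq_pow_bounds h0 h1 hn
    have : q ^ 4 ≤ 1 := pow_le_one₀ h0 h1
    constructor
    · exact div_nonneg (by linarith) hpos.le
    · rw [altSum, div_le_one hpos]
      linarith

lemma segmentValue_zero_right {q : ℝ} (a : ℕ) :
    segmentValue q a 0 = a * chainRate q + chainRate q * q ^ 2 * altSum q a := by
  simp [segmentValue, segmentGain, altSum]
  ring

lemma segmentValue_zero_right_le {q : ℝ} (h0 : 0 ≤ q) (h1 : q ≤ 1) (a : ℕ) :
    segmentValue q a 0 ≤ a * chainRate q + 1 := by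
  rw [segmentValue_zero_right]
  have h2 := altSum_mem h0 h1 a
  have h3 : chainRate q * q ^ 2 ≤ 1 :=
    mul_le_one₀ (chainRate_le_one q) (by positivity) (by nlinarith)
  have := mul_le_one₀ h3 h2.1 h2.2
  linarith

/-- Here the smallest factor, at `n = 2`, is nonpositive and the largest, at `n = 1`, is positive.
The product is least when these two are paired; equal signs make it nonnegative. -/
lemma segmentGain_le_one_two {q : ℝ} (h0 : 0 ≤ q) (h1 : q ≤ 1) (h : 1 ≤ q + q ^ 4)
    {a b : ℕ} (ha : 1 ≤ a) (hb : 1 ≤ b) : segmentGain q a b ≤ segmentGain q 1 2 := by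
  refine le_of_mul_le_mul_left ?_ (one_add_sq_pos q)
  rw [one_add_sq_mul_segmentGain, one_add_sq_mul_segmentGain]
  obtain ⟨hA1, hA2⟩ := neg_sq_pow_bounds h0 h1 ha
  obtain ⟨hB1, hB2⟩ := neg_sq_pow_bounds h0 h1 hb
  generalize (-q ^ 2) ^ a = A at *
  generalize (-q ^ 2) ^ b = B at *
  have e2 : (-q ^ 2) ^ 2 = q ^ 4 := by ring
  rw [pow_one, e2]
  have hu : 0 ≤ 1 + q ^ 2 - q := by nlinarith
  have hv : 0 ≤ q + q ^ 4 - 1 := by linarith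
  by_cases hA : 1 - A - q ≤ 0 <;> by_cases hB : 1 - B - q ≤ 0
  · nlinarith [mul_nonneg_of_nonpos_of_nonpos hA hB, mul_nonneg hu hv]
  · push Not at hB
    nlinarith [mul_le_mul (show q + A - 1 ≤ q + q ^ 4 - 1 by linarith)
      (show 1 - B - q ≤ 1 + q ^ 2 - q by linarith) hB.le hv]
  · push Not at hA
    nlinarith [mul_le_mul (show q + B - 1 ≤ q + q ^ 4 - 1 by linarith)
      (show 1 - A - q ≤ 1 + q ^ 2 - q by linarith) hA.le hv]
  · push Not at hA hB
    nlinarith [mul_nonneg hA.le hB.le, mul_nonneg hu hv]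

/-- Now all factors are nonnegative, so the product is least when both are smallest. -/
lemma segmentGain_le_two_two {q : ℝ} (h0 : 0 ≤ q) (h1 : q ≤ 1) (h : q + q ^ 4 ≤ 1)
    {a b : ℕ} (ha : 1 ≤ a) (hb : 1 ≤ b) : segmentGain q a b ≤ segmentGain q 2 2 := by
  refine le_of_mul_le_mul_left ?_ (one_add_sq_pos q)
  rw [one_add_sq_mul_segmentGain, one_add_sq_mul_segmentGain]
  obtain ⟨-, hA2⟩ := neg_sq_pow_bounds h0 h1 ha
  obtain ⟨-, hB2⟩ := neg_sq_pow_bounds h0 h1 hb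
  have e2 : (-q ^ 2) ^ 2 = q ^ 4 := by ring
  rw [e2]
  have := mul_le_mul (show 1 - q ^ 4 - q ≤ 1 - (-q ^ 2) ^ a - q by linarith)
    (show 1 - q ^ 4 - q ≤ 1 - (-q ^ 2) ^ b - q by linarith) (by linarith) (by linarith)
  linarith

/-- The gain is exactly `-(1 - q)^2`. -/
lemma segmentGain_one_one_nonpos (q : ℝ) : segmentGain q 1 1 ≤ 0 := by
  have := one_add_sq_mul_segmentGain q 1 1
  rw [pow_one] at this
  nlinarith [sq_nonneg (q * (1 - q)), sq_nonneg (1 - q), one_add_sq_pos q]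

lemma segmentGain_one_le {q : ℝ} (h0 : 0 ≤ q) (h1 : q ≤ 1) {b : ℕ} (hb : 1 ≤ b) :
    segmentGain q 1 b ≤ segmentGain q 1 2 := by
  refine le_of_mul_le_mul_left ?_ (one_add_sq_pos q)
  rw [one_add_sq_mul_segmentGain, one_add_sq_mul_segmentGain]
  obtain ⟨-, hB2⟩ := neg_sq_pow_bounds h0 h1 hb
  have e2 : (-q ^ 2) ^ 2 = q ^ 4 := by ring
  rw [e2, pow_one]
  have hu : 0 ≤ 1 + q ^ 2 - q := by nlinarith
  nlinarith [mul_le_mul_of_nonneg_left hB2 hu]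

/-- For odd `b` the power is nonpositive, so the gain is at most its value with the power replaced
by `0`. The factor `2 / 3` is what the weight `2 / (n + 2)` of `tau2`, a value per three messages,
requires. -/
lemma segmentGain_one_odd_le {q : ℝ} (h1 : q ≤ 1) {b : ℕ} (hb : Odd b) :
    segmentGain q 1 b ≤ 2 / 3 * segmentGain q 1 2 := by
  refine le_of_mul_le_mul_left ?_ (one_add_sq_pos q)
  rw [mul_left_comm, one_add_sq_mul_segmentGain, one_add_sq_mul_segmentGain]
  have hB : (-q ^ 2) ^ b ≤ 0 := hb.pow_nonpos (by nlinarith [sq_nonneg q])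
  have e2 : (-q ^ 2) ^ 2 = q ^ 4 := by ring
  rw [e2, pow_one]
  have hu : 0 ≤ 1 + q ^ 2 - q := by nlinarith
  have h2 := mul_le_mul_of_nonneg_left hB hu
  suffices 3 * (q ^ 2 - (1 - -q ^ 2 - q) * (1 - q))
      ≤ 2 * (q ^ 2 - (1 - -q ^ 2 - q) * (1 - q ^ 4 - q)) by nlinarith
  -- The inequality amounts to `q^3 - (1 - q)^2 ≤ 2 * q^4 * (1 - q + q^2)`.
  nlinarith [sq_nonneg (q ^ 3 - q ^ 2 / 2), sq_nonneg (q ^ 2 - q / 2), sq_nonneg (1 - q - q ^ 2 / 2),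
    sq_nonneg (1 - q), mul_nonneg (sq_nonneg q) (sq_nonneg (q - 2 / 3)), sq_nonneg (q ^ 2 - 1 / 2)]

/-- The best of the three periodic strategies. -/
def bestRate (q : ℝ) : ℝ :=
  max (max (chainRate q) (segmentValue q 1 2 / 3)) (segmentValue q 2 2 / 4)

lemma chainRate_le_bestRate (q : ℝ) : chainRate q ≤ bestRate q :=
  (le_max_left _ _).trans (le_max_left _ _)

lemma segmentValue_le {q : ℝ} (h0 : 0 ≤ q) (h1 : q ≤ 1) {a b : ℕ} (ha : 1 ≤ a) (hb : 1 ≤ b) :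
    segmentValue q a b ≤ (a + b) * bestRate q := by
  have hτq : 0 ≤ chainRate q * q := mul_nonneg (chainRate_nonneg h0) h0
  have ha' : (1 : ℝ) ≤ a := by exact_mod_cast ha
  have hb' : (1 : ℝ) ≤ b := by exact_mod_cast hb
  have hab : (0 : ℝ) ≤ a + b := by linarith
  have h12 : segmentValue q 1 2 / 3 ≤ bestRate q := (le_max_right _ _).trans (le_max_left _ _)
  have h22 : segmentValue q 2 2 / 4 ≤ bestRate q := le_max_right _ _
  -- comparison with a segment of `n ≤ a + b` messages and larger gain
  have main : ∀ {g : ℝ} {n : ℝ}, 0 < n → n ≤ a + b →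
      chainRate q + chainRate q * q * g / n ≤ bestRate q → segmentGain q a b ≤ g →
      segmentValue q a b ≤ (a + b) * bestRate q := by
    intro g n hn hnab hg hle
    have h3 := mul_le_mul_of_nonneg_left hle hτq
    -- A nonpositive gain is beaten by the chain; a positive one is diluted by spreading it over
    -- more messages.
    by_cases hneg : chainRate q * q * g ≤ 0
    · have := mul_le_mul_of_nonneg_left (chainRate_le_bestRate q) hab
      rw [segmentValue]
      linarith
    · push Not at hneg
      have h4 := mul_le_mul_of_nonneg_left hg hab
      have h5 : chainRate q * q * g ≤ (a + b) * (chainRate q * q * g / n) := by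
        rw [← mul_div_assoc, le_div_iff₀ hn, mul_comm]
        exact mul_le_mul_of_nonneg_right hnab hneg.le
      rw [segmentValue]
      linarith
  have g12 : chainRate q + chainRate q * q * segmentGain q 1 2 / 3 ≤ bestRate q := by
    refine le_trans (le_of_eq ?_) h12
    rw [segmentValue]; push_cast; ring
  have g22 : chainRate q + chainRate q * q * segmentGain q 2 2 / 4 ≤ bestRate q := by
    refine le_trans (le_of_eq ?_) h22
    rw [segmentValue]; push_cast; ring
  -- The short lengths are separate because the comparison segment must not be longer than `a + b`.
  by_cases h2 : a + b = 2
  · obtain rfl : a = 1 := by omega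
    obtain rfl : b = 1 := by omega
    refine main (g := 0) (n := 1) one_pos (by linarith) ?_ (segmentGain_one_one_nonpos q)
    simpa using chainRate_le_bestRate q
  have h3' : (3 : ℝ) ≤ a + b := by
    have : 3 ≤ a + b := by omega
    exact_mod_cast this
  rcases le_total 1 (q + q ^ 4) with h | h
  · exact main (by norm_num) h3' g12 (segmentGain_le_one_two h0 h1 h ha hb)
  · by_cases h3 : a + b = 3
    · refine main (by norm_num) h3' g12 ?_
      rcases (show a = 1 ∧ b = 2 ∨ a = 2 ∧ b = 1 by omega) with ⟨rfl, rfl⟩ | ⟨rfl, rfl⟩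
      · exact le_rfl
      · exact (segmentGain_comm q 2 1).le
    · have h4' : (4 : ℝ) ≤ a + b := by
        have : 4 ≤ a + b := by omega
        exact_mod_cast this
      exact main (by norm_num) h4' g22 (segmentGain_le_two_two h0 h1 h ha hb)

/-! ### The three values of the theorem -/

lemma tau1_eq {p : ℝ} (hp0 : 0 ≤ p) (hp1 : p ≤ 1) : tau1 p = chainRate (1 - p) := by
  rw [tau1, chainRate]
  obtain ⟨q, rfl⟩ : ∃ q, p = 1 - q := ⟨1 - p, by ring⟩
  have hq0 : 0 ≤ q := by linarith
  simp only [sub_sub_cancel]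
  -- At `q = 1` the geometric ratio `q^4` is `1`, but the prefactor `(1 - q^2)^2` vanishes.
  rcases eq_or_lt_of_le (show q ≤ 1 by linarith) with rfl | hq1
  · norm_num
  have h4 : q ^ 4 < 1 := pow_lt_one₀ hq0 hq1 (by norm_num)
  have e : ∀ i : ℕ, 1 / 2 * (1 - q ^ 2) ^ 2 * q ^ (4 * (i + 1) + 1)
      = 1 / 2 * (1 - q ^ 2) ^ 2 * q ^ 5 * (q ^ 4) ^ i := fun i => by ring
  simp_rw [e]
  rw [tsum_mul_left, tsum_geometric_of_lt_one (by positivity) h4]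
  have := (one_add_sq_pos q).ne'
  have : 1 - q ^ 4 ≠ 0 := by linarith
  field_simp
  ring

lemma tau2_eq (p : ℝ) : tau2 p = segmentValue (1 - p) 1 2 / 3 := by
  have := (one_add_sq_pos (1 - p)).ne'
  simp only [tau2, segmentValue, chainRate, segmentGain, altSum]
  push_cast
  field_simp
  ring

lemma tau3_eq (p : ℝ) : tau3 p = segmentValue (1 - p) 2 2 / 4 := by
  have := (one_add_sq_pos (1 - p)).ne'
  simp only [tau3, segmentValue, chainRate, segmentGain, altSum]
  push_cast
  field_simp
  ring

lemma bestRate_eq {p : ℝ} (hp0 : 0 ≤ p) (hp1 : p ≤ 1) :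
    bestRate (1 - p) = max (max (tau1 p) (tau2 p)) (tau3 p) := by
  rw [tau1_eq hp0 hp1, tau2_eq, tau3_eq, bestRate]

/-- The weights may depend on `p`, so all of the weight goes to the largest value. -/
lemma boundedByConvexComb_of_le_max {p y : ℝ}
    (h : y ≤ max (max (tau1 p) (tau2 p)) (tau3 p)) : BoundedByConvexComb p y := by
  rcases le_max_iff.1 h with h | h
  · rcases le_max_iff.1 h with h | h
    · exact ⟨1, 0, 0, by simpa⟩
    · exact ⟨0, 1, 0, by simpa⟩
  · exact ⟨0, 0, 1, by simpa⟩

/-! ### Sums of activation probabilities -/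

/-- For every pattern, the number of active messages is at most the best rate per message, up to
a constant. -/
lemma sum_greedyProb_le {q : ℝ} (h0 : 0 ≤ q) (h1 : q ≤ 1) {x : ℕ → Bool} (hx : x 0 = false)
    (n : ℕ) : ∑ i ∈ Finset.range n, greedyProb q x i ≤ n * bestRate q + 1 := by
  have hτ := chainRate_le_bestRate q
  -- Invariant: `s` messages lie in completed segments, already bounded by the best rate, and the
  -- current segment has `a` falses and `b` trues so far.
  have hinv : ∀ n, ∃ s a b : ℕ, 1 ≤ a ∧ s + a + b = n + 1 ∧ (b = 0 ↔ x n = false) ∧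
      greedyProb q x n = segmentLast q a b ∧
      ∑ i ∈ Finset.range (n + 1), greedyProb q x i ≤ s * bestRate q + segmentValue q a b := by
    intro n
    induction n with
    | zero =>
      refine ⟨0, 1, 0, le_rfl, rfl, by simp [hx], (segmentLast_one_zero q).symm, ?_⟩
      rw [segmentValue_succ_zero, segmentValue_zero, segmentLast_one_zero]
      simp [greedyProb]
    | succ n ih =>
      obtain ⟨s, a, b, ha, hs, hb, hl, hsum⟩ := ih
      rw [Finset.sum_range_succ]
      cases hn : x n <;> cases hn1 : x (n + 1)
      · obtain rfl := hb.2 hn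
        have e : greedyProb q x (n + 1) = segmentLast q (a + 1) 0 := by
          rw [segmentLast_succ_zero, ← hl, greedyProb, hn, hn1, conflictProb]
        refine ⟨s, a + 1, 0, by omega, by omega, by simp, e, ?_⟩
        rw [segmentValue_succ_zero, e]
        linarith
      · obtain rfl := hb.2 hn
        have e : greedyProb q x (n + 1) = segmentLast q a 1 := by
          rw [segmentLast_one, ← hl, greedyProb, hn, hn1, conflictProb]
        refine ⟨s, a, 1, by omega, by omega, by simp, e, ?_⟩
        rw [segmentValue_succ, e]
        linarith
      · have hb1 : 1 ≤ b := by
          rcases Nat.eq_zero_or_pos b with h | h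
          · simp [hb.1 h] at hn
          · exact h
        have e : greedyProb q x (n + 1) = segmentLast q 1 0 := by
          rw [segmentLast_one_zero, greedyProb, hn, hn1, conflictProb]; ring
        refine ⟨s + a + b, 1, 0, by omega, by omega, by simp, e, ?_⟩
        have := segmentValue_le h0 h1 ha hb1
        rw [segmentValue_succ_zero, segmentValue_zero, e]
        push_cast
        linarith
      · obtain ⟨b, rfl⟩ : ∃ c, b = c + 1 := by
          rcases Nat.eq_zero_or_pos b with h | h
          · simp [hb.1 h] at hn
          · exact ⟨b - 1, by omega⟩
        have e : greedyProb q x (n + 1) = segmentLast q a (b + 2) := by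
          rw [segmentLast_succ_succ, ← hl, greedyProb, hn, hn1, conflictProb]
        refine ⟨s, a, b + 2, by omega, by omega, by simp, e, ?_⟩
        rw [segmentValue_succ, e]
        linarith
  rcases n with _ | n
  · simp
  obtain ⟨s, a, b, ha, hs, hb, hl, hsum⟩ := hinv n
  have hn : ((n + 1 : ℕ) : ℝ) = s + a + b := by rw [← hs]; push_cast; ring
  rw [hn]
  rcases Nat.eq_zero_or_pos b with rfl | hb1
  -- A last segment without trues can exceed the best rate; this is the source of the additive `1`.
  · have h2 := segmentValue_zero_right_le h0 h1 a
    have := mul_le_mul_of_nonneg_left hτ (Nat.cast_nonneg (α := ℝ) a)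
    push_cast
    linarith
  · have := segmentValue_le h0 h1 ha hb1
    linarith

/-- Along a segment that starts afresh, the activation probabilities add up to the segment
value. -/
lemma sum_greedyProb_segment {q : ℝ} {x : ℕ → Bool} {s a b : ℕ} (ha : 1 ≤ a)
    (hs : greedyProb q x s = q)
    (hxa : ∀ i < a, x (s + i) = false) (hxb : ∀ i < b, x (s + a + i) = true) :
    ∑ i ∈ Finset.range (s + a + b), greedyProb q x i
      = ∑ i ∈ Finset.range s, greedyProb q x i + segmentValue q a b := by
  have hA : ∀ k < a, greedyProb q x (s + k) = segmentLast q (k + 1) 0 ∧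
      ∑ i ∈ Finset.range (s + k + 1), greedyProb q x i
        = ∑ i ∈ Finset.range s, greedyProb q x i + segmentValue q (k + 1) 0 := by
    intro k
    induction k with
    | zero =>
      intro _
      rw [Finset.sum_range_succ, segmentValue_succ_zero, segmentValue_zero,
        segmentLast_one_zero, add_zero, hs, zero_add]
      exact ⟨rfl, rfl⟩
    | succ k ih =>
      intro hk
      obtain ⟨h1, h2⟩ := ih (by omega)
      have e : greedyProb q x (s + (k + 1)) = segmentLast q (k + 1 + 1) 0 := by
        rw [segmentLast_succ_zero, ← h1, ← add_assoc, greedyProb, hxa k (by omega),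
          add_assoc, hxa (k + 1) hk, conflictProb]
      refine ⟨e, ?_⟩
      rw [Finset.sum_range_succ, e, segmentValue_succ_zero q (k + 1), ← add_assoc, ← add_assoc,
        h2]
  have hB : ∀ k ≤ b, greedyProb q x (s + a + k - 1) = segmentLast q a k ∧
      ∑ i ∈ Finset.range (s + a + k), greedyProb q x i
        = ∑ i ∈ Finset.range s, greedyProb q x i + segmentValue q a k := by
    intro k
    induction k with
    | zero =>
      intro _
      obtain ⟨a, rfl⟩ : ∃ c, a = c + 1 := ⟨a - 1, by omega⟩
      exact hA a (by omega)
    | succ k ih =>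
      intro hk
      obtain ⟨h1, h2⟩ := ih (by omega)
      have e : greedyProb q x (s + a + k) = segmentLast q a (k + 1) := by
        obtain ⟨m, hm⟩ : ∃ m, s + a + k = m + 1 := ⟨s + a + k - 1, by omega⟩
        have hm' : x (m + 1) = true := by rw [← hm]; exact hxb k (by omega)
        rw [hm, Nat.add_sub_cancel] at h1
        rw [hm, greedyProb, hm', h1]
        rcases k with _ | k
        · have : x m = false := by
            have := hxa (a - 1) (by omega)
            rwa [show s + (a - 1) = m by omega] at this
          rw [this, conflictProb, segmentLast_one]
        · have : x m = true := by
            have := hxb k (by omega)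
            rwa [show s + a + k = m by omega] at this
          rw [this, conflictProb, segmentLast_succ_succ]
      refine ⟨e, ?_⟩
      rw [← add_assoc, Finset.sum_range_succ, e, h2, segmentValue_succ, add_assoc]
  exact (hB b le_rfl).2

/-- Periodic repetition of a segment. -/
lemma sum_greedyProb_periodic {q : ℝ} {x : ℕ → Bool} {a b : ℕ} (ha : 1 ≤ a) (hb : 1 ≤ b)
    (k : ℕ) (hx : ∀ i < (a + b) * k, x i = decide (a ≤ i % (a + b))) :
    ∑ i ∈ Finset.range ((a + b) * k), greedyProb q x i = k * segmentValue q a b := by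
  induction k with
  | zero => simp
  | succ k ih =>
    have ih := ih fun i hi => hx i (hi.trans_le (Nat.mul_le_mul_left _ (Nat.le_succ k)))
    have hval : ∀ i < a + b, x ((a + b) * k + i) = decide (a ≤ i) := fun i hi => by
      rw [hx _ (by rw [mul_add, mul_one]; omega), Nat.mul_add_mod, Nat.mod_eq_of_lt hi]
    -- Each later period begins with a change from true to false, where no conflict is possible.
    have hstart : greedyProb q x ((a + b) * k) = q := by
      rcases k with _ | k
      · rfl
      · have h1 := hval 0 (by omega)
        have h2 := hx ((a + b) * k + (a + b - 1)) (by
          rw [mul_add (a + b) (k + 1), mul_add]; omega)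
        rw [Nat.mul_add_mod, Nat.mod_eq_of_lt (by omega), decide_eq_true (by omega)] at h2
        rw [add_zero, decide_eq_false (by omega)] at h1
        have e : (a + b) * (k + 1) = (a + b) * k + (a + b - 1) + 1 := by
          rw [mul_add]; omega
        rw [e] at h1 ⊢
        rw [greedyProb, h1, h2, conflictProb]
        ring
    have := sum_greedyProb_segment (b := b) ha hstart
      (fun i hi => by rw [hval i (by omega), decide_eq_false (by omega)])
      (fun i hi => by rw [add_assoc, hval (a + i) (by omega), decide_eq_true (by omega)])
    rw [show (a + b) * (k + 1) = (a + b) * k + a + b by ring, this, ih]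
    push_cast
    ring

lemma sum_greedyProb_const {q : ℝ} {x : ℕ → Bool} (K : ℕ) (hx : ∀ i < K, x i = false) :
    ∑ i ∈ Finset.range K, greedyProb q x i = segmentValue q K 0 := by
  rcases Nat.eq_zero_or_pos K with rfl | hK
  · simp [segmentValue_zero]
  · simpa using sum_greedyProb_segment (s := 0) (b := 0) hK (q := q) (x := x) rfl
      (by simpa using hx) (by simp)

lemma tendsto_natCast_div_div (m : ℕ) (hm : 1 ≤ m) :
    Tendsto (fun K : ℕ => ((K / m : ℕ) : ℝ) / (K : ℝ)) atTop (𝓝 (1 / m)) := by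
  have h := (tendsto_nat_floor_mul_div_atTop (R := ℝ) (a := 1 / m) (by positivity)).comp
    (tendsto_natCast_atTop_atTop (R := ℝ))
  refine h.congr fun K => ?_
  simp only [Function.comp]
  rw [one_div_mul_eq_div, Nat.floor_div_natCast, Nat.floor_natCast]

lemma tendsto_sum_greedyProb_periodic {q : ℝ} (h0 : 0 ≤ q) (h1 : q ≤ 1) {a b : ℕ} (ha : 1 ≤ a)
    (hb : 1 ≤ b) {x : ℕ → ℕ → Bool}
    (hx : ∀ K, ∀ i < (a + b) * (K / (a + b)), x K i = decide (a ≤ i % (a + b))) :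
    Tendsto (fun K : ℕ => (∑ i ∈ Finset.range K, greedyProb q (x K) i) / (K : ℝ)) atTop
      (𝓝 (segmentValue q a b / (a + b))) := by
  have hm : 1 ≤ a + b := by omega
  have hlim := tendsto_natCast_div_div (a + b) hm
  have hlow := hlim.mul_const (segmentValue q a b)
  have hup := hlow.add (tendsto_const_div_atTop_nhds_zero_nat ((a + b : ℕ) : ℝ))
  have e : 1 / ((a + b : ℕ) : ℝ) * segmentValue q a b = segmentValue q a b / (a + b) := by
    push_cast; ring
  rw [e] at hlow
  rw [e, add_zero] at hup
  have hsplit : ∀ K, ∑ i ∈ Finset.range K, greedyProb q (x K) i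
      = ((K / (a + b) : ℕ) : ℝ) * segmentValue q a b
        + ∑ i ∈ Finset.range (K % (a + b)),
            greedyProb q (x K) ((a + b) * (K / (a + b)) + i) := fun K => by
    rw [← sum_greedyProb_periodic ha hb _ (hx K), ← Finset.sum_range_add, Nat.div_add_mod]
  refine tendsto_of_tendsto_of_tendsto_of_le_of_le hlow hup (fun K => ?_) (fun K => ?_)
  · simp only
    rw [hsplit, div_mul_eq_mul_div]
    gcongr
    exact le_add_of_nonneg_right (Finset.sum_nonneg fun i _ => (greedyProb_mem h0 h1 _ _).1)
  · simp only
    rw [hsplit, div_mul_eq_mul_div, ← add_div]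
    gcongr
    calc _ ≤ ∑ i ∈ Finset.range (K % (a + b)), (1 : ℝ) :=
          Finset.sum_le_sum fun i _ => (greedyProb_mem h0 h1 _ _).2
      _ ≤ _ := by
        simp only [Finset.sum_const, Finset.card_range, nsmul_eq_mul, mul_one]
        exact_mod_cast (Nat.mod_lt K (by omega)).le

lemma tendsto_segmentValue_zero_right {q : ℝ} (h0 : 0 ≤ q) (h1 : q ≤ 1) :
    Tendsto (fun K : ℕ => segmentValue q K 0 / (K : ℝ)) atTop (𝓝 (chainRate q)) := by
  have hup := (tendsto_const_nhds (x := chainRate q)).add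
    (tendsto_const_div_atTop_nhds_zero_nat (1 : ℝ))
  rw [add_zero] at hup
  refine tendsto_of_tendsto_of_tendsto_of_le_of_le' tendsto_const_nhds hup ?_ ?_
  · filter_upwards [eventually_gt_atTop 0] with K hK
    have hK' : (0 : ℝ) < K := by exact_mod_cast hK
    rw [le_div_iff₀ hK', segmentValue_zero_right]
    have := mul_nonneg (mul_nonneg (chainRate_nonneg h0) (sq_nonneg q)) (altSum_mem h0 h1 K).1
    linarith
  · filter_upwards [eventually_gt_atTop 0] with K hK
    have hK' : (0 : ℝ) < K := by exact_mod_cast hK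
    rw [div_le_iff₀ hK', add_mul, div_mul_cancel₀ _ hK'.ne']
    have := segmentValue_zero_right_le h0 h1 K
    linarith

/-! ### Expectations over the erasures -/

/-- The expectation of `F` over the erasures when a link is on with probability `q`. -/
def erasureMean {K : ℕ} (q : ℝ) (F : Topology K → ℝ) : ℝ :=
  ∑ ω : Topology K, Topology.prob (1 - q) ω * F ω

lemma erasureMean_one {K : ℕ} (q : ℝ) : erasureMean (K := K) q (fun _ => 1) = 1 := by
  have h := Fintype.prod_sum (ι := Link K) (κ := fun _ => Bool)
    (fun _ b => if b = true then q else 1 - q)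
  simp only [Fintype.sum_bool] at h
  simpa [erasureMean, Topology.prob] using h.symm

lemma erasureMean_add {K : ℕ} (q : ℝ) (F G : Topology K → ℝ) :
    erasureMean q (fun ω => F ω + G ω) = erasureMean q F + erasureMean q G := by
  simp [erasureMean, mul_add, Finset.sum_add_distrib]

lemma erasureMean_sub {K : ℕ} (q : ℝ) (F G : Topology K → ℝ) :
    erasureMean q (fun ω => F ω - G ω) = erasureMean q F - erasureMean q G := by
  simp [erasureMean, mul_sub, Finset.sum_sub_distrib]

lemma erasureMean_sum {K : ℕ} {ι : Type*} (q : ℝ) (s : Finset ι) (F : ι → Topology K → ℝ) :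
    erasureMean q (fun ω => ∑ i ∈ s, F i ω) = ∑ i ∈ s, erasureMean q (F i) := by
  simp only [erasureMean, Finset.mul_sum]
  exact Finset.sum_comm

lemma Topology.prob_nonneg {K : ℕ} {p : ℝ} (h0 : 0 ≤ p) (h1 : p ≤ 1) (ω : Topology K) :
    0 ≤ ω.prob p :=
  Finset.prod_nonneg fun l _ => by split_ifs <;> linarith

/-- `F` does not depend on the link `l`. -/
def IgnoresLink {K : ℕ} {α : Type*} (F : Topology K → α) (l : Link K) : Prop :=
  ∀ ω b, F (Function.update ω l b) = F ω

/-- A link is on independently of the other links. -/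
lemma erasureMean_link_mul {K : ℕ} (q : ℝ) {F : Topology K → ℝ} {l : Link K}
    (hF : IgnoresLink F l) :
    erasureMean q (fun ω => (if ω l = true then 1 else 0) * F ω) = q * erasureMean q F := by
  classical
  -- Flipping `l` pairs realizations whose weights differ by the ratio of `q` to `1 - q`.
  -- Cross-multiplying avoids division and so covers `q = 0` and `q = 1`.
  have hflip : Function.Involutive
      (fun ω : Topology K => Function.update ω l (!ω l)) := fun ω => by
    simp
  have hterm : ∀ ω : Topology K,
      Topology.prob (1 - q) ω * ((if ω l = true then 1 else 0) * F ω) * (1 - q)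
        = Topology.prob (1 - q) (Function.update ω l (!ω l))
          * ((if (Function.update ω l (!ω l)) l = true then 0 else 1)
            * F (Function.update ω l (!ω l))) * q := fun ω => by
    rw [hF, Function.update_self]
    rcases hl : ω l
    · simp
    · have h1 := Finset.mul_prod_erase Finset.univ
        (fun l' => if ω l' = true then 1 - (1 - q) else 1 - q) (Finset.mem_univ l)
      have h2 := Finset.mul_prod_erase Finset.univ
        (fun l' => if Function.update ω l (!ω l) l' = true then 1 - (1 - q) else 1 - q)
        (Finset.mem_univ l)
      have h3 : ∏ l' ∈ Finset.univ.erase l,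
            (if Function.update ω l (!ω l) l' = true then 1 - (1 - q) else 1 - q)
          = ∏ l' ∈ Finset.univ.erase l, (if ω l' = true then 1 - (1 - q) else 1 - q) :=
        Finset.prod_congr rfl fun l' hl' => by
          rw [Function.update_of_ne (Finset.ne_of_mem_erase hl')]
      rw [h3] at h2
      rw [hl] at h2
      simp only [hl, Function.update_self, Bool.not_true, Bool.false_eq_true, if_false,
        if_true] at h1 h2
      simp only [Topology.prob]
      rw [Bool.not_true, ← h1, ← h2]
      simp
      ring
  have hsum : erasureMean q (fun ω => (if ω l = true then 1 else 0) * F ω) * (1 - q)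
      = erasureMean q (fun ω => (if ω l = true then 0 else 1) * F ω) * q := by
    simp only [erasureMean, Finset.sum_mul]
    rw [Finset.sum_congr rfl fun ω _ => hterm ω]
    exact Equiv.sum_comp hflip.toPerm (fun ω : Topology K => Topology.prob (1 - q) ω
      * ((if ω l = true then 0 else 1) * F ω) * q)
  have hadd := erasureMean_add q (fun ω => (if ω l = true then 1 else 0) * F ω)
    (fun ω => (if ω l = true then 0 else 1) * F ω)
  have : (fun ω : Topology K => (if ω l = true then 1 else 0) * F ω
      + (if ω l = true then 0 else 1) * F ω) = F := by
    funext ω; split_ifs <;> simp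
  rw [this] at hadd
  linear_combination hsum + q * (-hadd)

/-! ### The greedy schedule of an irreducible assignment -/

/-- Whether the link from transmitter `j` to receiver `i` is on, with natural-number indices. -/
def linkOn {K : ℕ} (ω : Topology K) (i j : ℕ) : Bool :=
  if h : ∃ (hi : i < K) (hj : j < K), i = j ∨ i = j + 1 then
    ω ⟨(⟨i, h.1⟩, ⟨j, h.2.1⟩), by simpa [Fin.ext_iff] using h.2.2⟩ else false

lemma linkOn_iff {K : ℕ} (ω : Topology K) (i j : Fin K) :
    linkOn ω i j = true ↔ Connected ω i j := by
  unfold linkOn Connected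
  constructor
  · intro h
    split_ifs at h with h'
    exact ⟨by simpa [Fin.ext_iff] using h'.2.2, h⟩
  · rintro ⟨h, h'⟩
    rw [dif_pos ⟨i.2, j.2, by simpa [Fin.ext_iff] using h⟩]
    exact h'

lemma linkOn_eq {K : ℕ} (ω : Topology K) {i j : ℕ} (hi : i < K) (hj : j < K)
    (h : i = j ∨ i = j + 1) :
    linkOn ω i j = ω ⟨(⟨i, hi⟩, ⟨j, hj⟩), by simpa [Fin.ext_iff] using h⟩ :=
  dif_pos ⟨hi, hj, h⟩

/-- The transmitter of message `i` in the pattern `x`: the previous one if `x i`, and its own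
otherwise. -/
def sender (x : ℕ → Bool) (i : ℕ) : ℕ := if x i then i - 1 else i

/-- Whether messages `n` and `n + 1` collide, given that both their links are on. -/
def conflict {K : ℕ} (x : ℕ → Bool) (ω : Topology K) (n : ℕ) : Bool :=
  match x n, x (n + 1) with
  | false, false => linkOn ω (n + 1) n
  | true, true => linkOn ω n n
  | false, true => true
  | true, false => false

/-- The greedy schedule: a message is active if its link is on and it does not collide with an
active previous message. -/
def greedy {K : ℕ} (x : ℕ → Bool) (ω : Topology K) : ℕ → Bool
  | 0 => linkOn ω 0 (sender x 0)
  | n + 1 => linkOn ω (n + 1) (sender x (n + 1)) && !(conflict x ω n && greedy x ω n)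

/-- The assignment `T` gives message `i` to the transmitter `sender x i`. -/
def FollowsPattern {K : ℕ} (T : Assignment K) (x : ℕ → Bool) : Prop :=
  x 0 = false ∧ ∀ i j : Fin K, j ∈ T i ↔ (j : ℕ) = sender x i

lemma greedy_le_linkOn {K : ℕ} {x : ℕ → Bool} {ω : Topology K} {n : ℕ}
    (h : greedy x ω n = true) : linkOn ω n (sender x n) = true := by
  cases n with
  | zero => exact h
  | succ n =>
    rw [greedy, Bool.and_eq_true] at h
    exact h.1

lemma sender_lt {K : ℕ} (x : ℕ → Bool) (i : Fin K) : sender x i < K := by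
  unfold sender
  have := i.2
  split_ifs <;> omega

lemma linkOn_near {K : ℕ} {ω : Topology K} {i j : ℕ} (h : linkOn ω i j = true) :
    i = j ∨ i = j + 1 := by
  unfold linkOn at h
  split_ifs at h with h'
  exact h'.2.2

/-- Collisions occur between neighbouring messages only, and are described by `conflict`. -/
lemma interference_iff {K : ℕ} {x : ℕ → Bool} (hx : x 0 = false) {ω : Topology K} {m n : ℕ}
    (hmn : m < n)
    (hm : linkOn ω m (sender x m) = true) :
    (linkOn ω m (sender x n) = true ∨ linkOn ω n (sender x m) = true) ↔
      n = m + 1 ∧ conflict x ω m = true := by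
  constructor
  · rintro (h | h)
    · have hnear := linkOn_near h
      have hxn : x n = true := by
        by_contra hxn
        simp only [sender, hxn] at hnear
        simp at hnear
        omega
      simp only [sender, hxn, if_true] at hnear h
      obtain rfl : n = m + 1 := by omega
      refine ⟨rfl, ?_⟩
      rw [Nat.add_sub_cancel] at h
      unfold conflict
      cases x m <;> simp [hxn, h]
    · have hnear := linkOn_near h
      have hxm : x m = false := by
        by_contra hxm
        rw [Bool.not_eq_false] at hxm
        -- Truncated subtraction would give message `0` the sender `0` even if `x 0` were true.
        have h0 : m ≠ 0 := by
          rintro rfl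
          rw [hx] at hxm
          cases hxm
        simp only [sender, hxm, if_true] at hnear
        omega
      simp only [sender, hxm] at hnear h
      simp only [Bool.false_eq_true, if_false] at hnear h
      obtain rfl : n = m + 1 := by omega
      refine ⟨rfl, ?_⟩
      unfold conflict
      cases x (m + 1) <;> simp [hxm, h]
  · rintro ⟨rfl, hc⟩
    unfold conflict at hc
    cases h1 : x m <;> cases h2 : x (m + 1) <;> simp only [h1, h2] at hc
    · right
      simpa [sender, h1] using hc
    -- Both messages share transmitter `m`, so the link carrying message `m` also carries the
    -- interference.
    · left
      simpa [sender, h1, h2] using hm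
    · cases hc
    · left
      simpa [sender, h2] using hc

/-- The greedy schedule as a set of transmissions. -/
def greedySet {K : ℕ} (x : ℕ → Bool) (ω : Topology K) : Finset (Fin K × Fin K) :=
  (Finset.univ.filter fun i : Fin K => greedy x ω i = true).map
    ⟨fun i => (i, ⟨sender x i, sender_lt x i⟩), fun _ _ h => (Prod.ext_iff.1 h).1⟩

lemma card_greedySet {K : ℕ} (x : ℕ → Bool) (ω : Topology K) :
    (greedySet x ω).card = ∑ i ∈ Finset.range K, if greedy x ω i = true then 1 else 0 := by
  rw [greedySet, Finset.card_map, Finset.card_filter,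
    Finset.sum_range fun i => if greedy x ω i = true then 1 else 0]

lemma feasible_greedySet {K : ℕ} {T : Assignment K} {x : ℕ → Bool} (hT : FollowsPattern T x)
    (ω : Topology K) : Feasible ω T (greedySet x ω) := by
  have key : ∀ m n : ℕ, m < n → greedy x ω m = true → greedy x ω n = true →
      ¬ (linkOn ω m (sender x n) = true ∨ linkOn ω n (sender x m) = true) := by
    intro m n hmn hm hn h
    obtain ⟨rfl, hc⟩ := (interference_iff hT.1 hmn (greedy_le_linkOn hm)).1 h
    rw [greedy, hc, hm] at hn
    simp at hn
  refine ⟨?_, ?_, ?_⟩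
  · intro a ha
    simp only [greedySet, Finset.mem_map, Finset.mem_filter] at ha
    obtain ⟨i, -, rfl⟩ := ha
    exact (hT.2 _ _).2 rfl
  · intro a ha
    simp only [greedySet, Finset.mem_map, Finset.mem_filter] at ha
    obtain ⟨i, ⟨-, hi⟩, rfl⟩ := ha
    exact (linkOn_iff ω _ _).1 (greedy_le_linkOn hi)
  · intro a ha b hb hab
    simp only [greedySet, Finset.mem_map, Finset.mem_filter] at ha hb
    obtain ⟨i, ⟨-, hi⟩, rfl⟩ := ha
    obtain ⟨j, ⟨-, hj⟩, rfl⟩ := hb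
    rw [← linkOn_iff]
    intro h
    rcases lt_trichotomy (i : ℕ) j with hij | hij | hij
    · exact key i j hij hi hj (Or.inl h)
    · exact hab (by rw [Fin.ext hij])
    · exact key j i hij hj hi (Or.inr h)

lemma Feasible.card_le_greedy {K : ℕ} {T : Assignment K} {x : ℕ → Bool}
    (hT : FollowsPattern T x) {ω : Topology K} {A : Finset (Fin K × Fin K)}
    (hA : Feasible ω T A) :
    A.card ≤ ∑ i ∈ Finset.range K, if greedy x ω i = true then 1 else 0 := by
  classical
  -- the active messages
  set B : Finset ℕ := A.image fun a => (a.1 : ℕ) with hB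
  have hsnd : ∀ a ∈ A, (a.2 : ℕ) = sender x a.1 := fun a ha => (hT.2 _ _).1 (hA.known a ha)
  have hcard : B.card = A.card := Finset.card_image_of_injOn fun a ha b hb h => by
    have h1 : a.1 = b.1 := Fin.ext h
    refine Prod.ext h1 (Fin.ext ?_)
    rw [hsnd a ha, hsnd b hb, h1]
  have hon : ∀ n ∈ B, linkOn ω n (sender x n) = true := by
    intro n hn
    obtain ⟨a, ha, rfl⟩ := Finset.mem_image.1 hn
    rw [← hsnd a ha]
    exact (linkOn_iff ω _ _).2 (hA.linked a ha)
  have hno : ∀ n, n ∈ B → n + 1 ∈ B → conflict x ω n = false := by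
    intro n hn hn1
    by_contra hc
    rw [Bool.not_eq_false] at hc
    have h := (interference_iff hT.1 (Nat.lt_succ_self n) (hon n hn)).2 ⟨rfl, hc⟩
    obtain ⟨a, ha, rfl⟩ := Finset.mem_image.1 hn
    obtain ⟨b, hb, hb1⟩ := Finset.mem_image.1 hn1
    have hab : a ≠ b := by
      rintro rfl
      omega
    rw [← hsnd a ha, Nat.succ_eq_add_one, ← hb1, ← hsnd b hb, linkOn_iff, linkOn_iff] at h
    rcases h with h | h
    · exact hA.orthogonal a ha b hb hab h
    · exact hA.orthogonal b hb a ha hab.symm h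
  have hsplit : ∀ n, (B.filter (· < n + 1)).card
      = (B.filter (· < n)).card + if n ∈ B then 1 else 0 := by
    intro n
    have : B.filter (· < n + 1) = B.filter (· < n) ∪ B.filter (· = n) := by
      ext k
      simp only [Finset.mem_union, Finset.mem_filter]
      rw [Nat.lt_succ_iff_lt_or_eq]
      tauto
    rw [this, Finset.card_union_of_disjoint, Finset.filter_eq']
    · split_ifs <;> simp
    · rw [Finset.disjoint_filter]
      intro k _ h
      omega
  -- Two consecutive prefixes are needed: if `B` contains `n + 1` and greedy skips it, greedy took
  -- `n` and `B` did not, so the comparison goes back to the prefix below `n`.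
  have hle : ∀ n, (B.filter (· < n)).card
        ≤ ∑ i ∈ Finset.range n, (if greedy x ω i = true then 1 else 0) ∧
      (B.filter (· < n + 1)).card
        ≤ ∑ i ∈ Finset.range (n + 1), (if greedy x ω i = true then 1 else 0) := by
    intro n
    induction n with
    | zero =>
      rw [hsplit]
      refine ⟨by simp, ?_⟩
      by_cases h : 0 ∈ B
      · have := hon 0 h
        have hg : greedy x ω 0 = true := this
        rw [zero_add, Finset.sum_range_one, if_pos hg, if_pos h]
        simp
      · simp [h]
    | succ n ih =>
      refine ⟨ih.2, ?_⟩
      rw [hsplit (n + 1), Finset.sum_range_succ]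
      by_cases h : n + 1 ∈ B
      · have hv := hon _ h
        by_cases hg : greedy x ω (n + 1) = true
        · simp only [h, hg, if_true]
          omega
        · have h2 : conflict x ω n = true ∧ greedy x ω n = true := by
            rw [greedy, hv] at hg
            simpa using hg
          have h3 : n ∉ B := fun hn => by
            have := hno n hn h
            rw [h2.1] at this
            cases this
          have h4 := hsplit n
          have h5 := ih.1
          rw [Finset.sum_range_succ]
          rw [if_neg h3] at h4
          rw [if_pos h, if_pos h2.2, if_neg hg]
          omega
      · simp only [h, if_false]
        have := ih.2
        omega
  have hBK : B.filter (· < K) = B := Finset.filter_true_of_mem fun n hn => by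
    obtain ⟨a, ha, rfl⟩ := Finset.mem_image.1 hn
    exact a.1.2
  rw [← hcard, ← hBK]
  exact (hle K).1

lemma maxActive_eq_sum_greedy {K : ℕ} {T : Assignment K} {x : ℕ → Bool}
    (hT : FollowsPattern T x) (ω : Topology K) :
    maxActive ω T = ∑ i ∈ Finset.range K, if greedy x ω i = true then 1 else 0 := by
  apply le_antisymm
  · exact maxActive_le fun A hA => hA.card_le_greedy hT
  · rw [← card_greedySet]
    exact (feasible_greedySet hT ω).card_le

/-! ### The mean of the greedy schedule -/

lemma linkOn_update {K : ℕ} (ω : Topology K) {i j : ℕ} {l : Link K} (b : Bool)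
    (h : i ≠ (l.1.1 : ℕ) ∨ j ≠ (l.1.2 : ℕ)) :
    linkOn (Function.update ω l b) i j = linkOn ω i j := by
  unfold linkOn
  split_ifs with h'
  · rw [Function.update_of_ne]
    rintro rfl
    simp at h
  · rfl

/-- The greedy decision on message `n` does not depend on the links to later receivers. -/
lemma greedy_update_later {K : ℕ} (x : ℕ → Bool) (ω : Topology K) {l : Link K} (b : Bool)
    {n : ℕ} (h : n < (l.1.1 : ℕ)) :
    greedy x (Function.update ω l b) n = greedy x ω n := by
  induction n with
  | zero => rw [greedy, greedy, linkOn_update ω b (Or.inl (by omega))]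
  | succ n ih =>
    have hc : conflict x (Function.update ω l b) n = conflict x ω n := by
      unfold conflict
      cases x n <;> cases x (n + 1) <;> simp only
      · exact linkOn_update ω b (Or.inl (by omega))
      · exact linkOn_update ω b (Or.inl (by omega))
    rw [greedy, greedy, linkOn_update ω b (Or.inl (by omega)), ih (by omega), hc]

/-- The greedy decision on a message sent by the previous transmitter does not depend on the link
to its receiver from its own transmitter. -/
lemma greedy_update_diag {K : ℕ} {x : ℕ → Bool} (ω : Topology K) {l : Link K} (b : Bool)
    {n : ℕ} (hx0 : x 0 = false) (hx : x n = true) (h1 : n = (l.1.1 : ℕ)) (h2 : n = (l.1.2 : ℕ)) :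
    greedy x (Function.update ω l b) n = greedy x ω n := by
  cases n with
  | zero => rw [hx0] at hx; cases hx
  | succ n =>
    have hc : conflict x (Function.update ω l b) n = conflict x ω n := by
      unfold conflict
      cases x n <;> simp only [hx]
      exact linkOn_update ω b (Or.inl (by omega))
    have hs : sender x (n + 1) = n := by simp [sender, hx]
    rw [greedy, greedy, hs, linkOn_update ω b (Or.inr (by omega)),
      greedy_update_later x ω b (by omega), hc]

lemma erasureMean_greedy {K : ℕ} (q : ℝ) {x : ℕ → Bool} (hx0 : x 0 = false) {n : ℕ} (hn : n < K) :
    erasureMean (K := K) q (fun ω => if greedy x ω n = true then 1 else 0) = greedyProb q x n := by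
  induction n with
  | zero =>
    have e : ∀ ω : Topology K, greedy x ω 0 = ω ⟨(⟨0, hn⟩, ⟨0, hn⟩), Or.inl rfl⟩ := fun ω => by
      rw [greedy, sender, hx0]
      exact linkOn_eq ω hn hn (Or.inl rfl)
    simp only [e, greedyProb]
    have := erasureMean_link_mul (K := K) q (F := fun _ => 1)
      (l := ⟨(⟨0, hn⟩, ⟨0, hn⟩), Or.inl rfl⟩) (fun _ _ => rfl)
    rw [erasureMean_one] at this
    simpa using this
  | succ n ih =>
    have hn' : n < K := by omega
    have ih := ih hn'
    -- the link that carries message `n + 1`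
    have hs : n + 1 = sender x (n + 1) ∨ n + 1 = sender x (n + 1) + 1 := by
      unfold sender
      split_ifs <;> simp
    set l : Link K := ⟨(⟨n + 1, hn⟩, ⟨sender x (n + 1), sender_lt x ⟨n + 1, hn⟩⟩),
      by simpa [Fin.ext_iff] using hs⟩ with hl
    have hv : ∀ ω : Topology K, linkOn ω (n + 1) (sender x (n + 1)) = ω l := fun ω =>
      linkOn_eq ω hn _ hs
    set c : Topology K → ℝ := fun ω => if conflict x ω n = true then 1 else 0 with hc
    set g : Topology K → ℝ := fun ω => if greedy x ω n = true then 1 else 0 with hg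
    have hsplit : (fun ω : Topology K => if greedy x ω (n + 1) = true then (1 : ℝ) else 0)
        = fun ω => (if ω l = true then 1 else 0) * (1 - c ω * g ω) := by
      funext ω
      rw [greedy, hv]
      simp only [c, g]
      cases ω l <;> cases conflict x ω n <;> cases greedy x ω n <;> simp
    have hgl : ∀ l : Link K, n < (l.1.1 : ℕ) → IgnoresLink g l := fun l hl ω b => by
      simp only [g]
      rw [greedy_update_later x ω b hl]
    have hcl : IgnoresLink c l := fun ω b => by
      simp only [c]
      have : conflict x (Function.update ω l b) n = conflict x ω n := by
        unfold conflict
        cases h1 : x n <;> cases h2 : x (n + 1) <;> simp only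
        · exact linkOn_update ω b (Or.inr (by simp [l, sender, h2]))
        · exact linkOn_update ω b (Or.inl (by simp [l]))
      rw [this]
    have hind : IgnoresLink (fun ω => 1 - c ω * g ω) l := fun ω b => by
      simp only
      rw [hcl ω b, hgl l (by simp [l]) ω b]
    rw [hsplit, erasureMean_link_mul q hind, erasureMean_sub, erasureMean_one, greedyProb]
    suffices erasureMean q (fun ω => c ω * g ω)
        = conflictProb q (x n) (x (n + 1)) * greedyProb q x n by rw [this]
    rw [← ih]
    -- For equal values the conflict is decided by one link that does not influence the greedy
    -- decision on `n`: an incoming link of receiver `n + 1`, or the diagonal link at `n`.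
    cases h1 : x n <;> cases h2 : x (n + 1)
    · have hce : (fun ω => c ω * g ω) = fun ω : Topology K =>
          (if ω ⟨(⟨n + 1, hn⟩, ⟨n, hn'⟩), Or.inr rfl⟩ = true then 1 else 0) * g ω := by
        funext ω
        simp only [c, conflict, h1, h2]
        rw [linkOn_eq ω hn hn' (Or.inr rfl)]
      rw [hce, erasureMean_link_mul q (hgl _ (by simp)), conflictProb]
    · simp [c, conflict, h1, h2, conflictProb]
    · simp [c, conflict, h1, h2, conflictProb, erasureMean]
    · have hce : (fun ω => c ω * g ω) = fun ω : Topology K =>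
          (if ω ⟨(⟨n, hn'⟩, ⟨n, hn'⟩), Or.inl rfl⟩ = true then 1 else 0) * g ω := by
        funext ω
        simp only [c, conflict, h1, h2]
        rw [linkOn_eq ω hn' hn' (Or.inl rfl)]
      rw [hce, erasureMean_link_mul q, conflictProb]
      intro ω b
      simp only [g]
      rw [greedy_update_diag ω b hx0 h1 rfl rfl]

lemma avgDof_eq_sum_greedyProb {ν : Measure ℂ} [IsProbabilityMeasure ν]
    [NullSingletonClass ν] (hν : Integrable (fun h : ℂ => Real.log (1 + ‖h‖ ^ 2)) ν)
    (p : ℝ) {K : ℕ} {T : Assignment K} {x : ℕ → Bool} (hT : FollowsPattern T x) :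
    avgDof ν p T = ∑ i ∈ Finset.range K, greedyProb (1 - p) x i := by
  have h : avgDof ν p T = erasureMean (1 - p)
      (fun ω : Topology K => ∑ i ∈ Finset.range K, if greedy x ω i = true then (1 : ℝ) else 0) := by
    simp only [avgDof, erasureMean, sub_sub_cancel]
    refine Finset.sum_congr rfl fun ω _ => ?_
    rw [dof_eq_maxActive hν, maxActive_eq_sum_greedy hT]
    push_cast
    rfl
  rw [h, erasureMean_sum]
  exact Finset.sum_congr rfl fun i hi => erasureMean_greedy _ hT.1 (Finset.mem_range.1 hi)

/-! ### Assignments and their patterns -/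

lemma Irreducible.exists_pattern {K : ℕ} {T : Assignment K} (hT : Irreducible T) :
    ∃ x, FollowsPattern T x := by
  classical
  refine ⟨fun i => decide (∃ hi : i < K, (⟨i, hi⟩ : Fin K) ∉ T ⟨i, hi⟩), ?_, ?_⟩
  · rw [decide_eq_false_iff_not]
    rintro ⟨h0, h⟩
    obtain ⟨j, hj, h1 | h1⟩ := hT ⟨0, h0⟩
    · rw [hj, ← h1] at h
      simp at h
    · simp at h1
  · intro i j
    obtain ⟨k, hk, h⟩ := hT i
    have hi : (∃ hi : (i : ℕ) < K, (⟨i, hi⟩ : Fin K) ∉ T ⟨i, hi⟩) ↔ i ≠ k := by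
      constructor
      · rintro ⟨_, h2⟩
        simpa [hk] using h2
      · intro h2
        exact ⟨i.2, by simpa [hk] using h2⟩
    simp only [sender, decide_eq_true_eq]
    rw [if_congr hi rfl rfl, hk, Finset.mem_singleton]
    split_ifs with h3
    · have := h.resolve_left h3
      rw [Fin.ext_iff]
      omega
    · push Not at h3
      rw [h3, Fin.ext_iff]

/-- The single-transmitter assignment with a given pattern. -/
def patternAssignment (x : ℕ → Bool) (K : ℕ) : Assignment K :=
  fun i => {⟨sender x i, sender_lt x i⟩}

lemma followsPattern_patternAssignment {x : ℕ → Bool} (hx : x 0 = false) (K : ℕ) :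
    FollowsPattern (patternAssignment x K) x :=
  ⟨hx, fun i j => by simp [patternAssignment, Fin.ext_iff]⟩

/-- Only messages `i` and `i + 1` can use transmitter `i`. Hence the loads determine `x (i + 1)`
from `x i`, and the pattern follows from `x 0 = false`. -/
lemma FollowsPattern.load_eq {K : ℕ} {T : Assignment K} {x : ℕ → Bool}
    (hT : FollowsPattern T x) {i : ℕ} (hi : i + 1 < K) :
    load T ⟨i, by omega⟩ = (if x i = true then 0 else 1) + if x (i + 1) = true then 1 else 0 := by
  rw [load, Finset.card_filter]
  simp only [hT.2]
  rw [Finset.sum_fin_eq_sum_range]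
  have : ∀ k ∈ Finset.range K, (if h : k < K then if i = sender x k then 1 else 0 else 0)
      = (if k = i then (if x i = true then 0 else 1) else 0)
        + (if k = i + 1 then (if x (i + 1) = true then 1 else 0) else 0) := by
    intro k hk
    rw [dif_pos (Finset.mem_range.1 hk)]
    unfold sender
    by_cases h1 : k = i
    · subst h1
      cases hk : x k
      · simp
      · have : k ≠ 0 := by
          rintro rfl
          rw [hT.1] at hk
          cases hk
        have h2 : k ≠ k - 1 := by omega
        simp [h2]
    · by_cases h2 : k = i + 1
      · subst h2
        cases x (i + 1) <;> simp
      · have h3 : i ≠ k := fun h => h1 h.symm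
        have h4 : x k = true → i ≠ k - 1 := fun hk h => by
          have : k ≠ 0 := by
            rintro rfl
            rw [hT.1] at hk
            cases hk
          omega
        cases hk : x k
        · simp [h1, h2, h3]
        · simp [h1, h2, h4 hk]
  rw [Finset.sum_congr rfl this, Finset.sum_add_distrib, Finset.sum_ite_eq', Finset.sum_ite_eq',
    if_pos (Finset.mem_range.2 (by omega)), if_pos (Finset.mem_range.2 hi)]

lemma length_twoString (a b : ℕ) : (twoString a b).length = a + b + 2 := by
  simp [twoString]
  omega

/-- This is the load formula for `a + 1` falses followed by `b + 1` trues; at `r = a + b + 1` the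
next value wraps around to false. -/
lemma getD_twoString {a b r : ℕ} (hr : r < a + b + 2) :
    (twoString a b).getD r 1
      = (if a + 1 ≤ r then 0 else 1) + if a ≤ r ∧ r ≤ a + b then 1 else 0 := by
  unfold twoString
  simp only [List.getD_eq_getElem?_getD, List.getElem?_append, List.length_append,
    List.length_replicate, List.getElem?_replicate, List.length_singleton,
    List.getElem?_singleton]
  split_ifs <;> first | omega | simp

lemma FollowsPattern.eq_of_load_twoString {K : ℕ} {T : Assignment K} {x : ℕ → Bool} {a b : ℕ}
    (hT : FollowsPattern T x) (hload : load T = stringLoad (twoString a b) K) :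
    ∀ i < (a + 1 + (b + 1)) * (K / (a + 1 + (b + 1))),
      x i = decide (a + 1 ≤ i % (a + 1 + (b + 1))) := by
  have hm : a + 1 + (b + 1) = a + b + 2 := by ring
  rw [hm]
  have hle : (a + b + 2) * (K / (a + b + 2)) ≤ K := Nat.mul_div_le _ _
  intro i
  induction i with
  | zero => simp [hT.1]
  | succ i ih =>
    intro hi
    have hxi := ih (by omega)
    have h1 := hT.load_eq (i := i) (by omega)
    have hr : i % (a + b + 2) < a + b + 2 := Nat.mod_lt _ (by omega)
    rw [hload, stringLoad, length_twoString, if_pos (by simp only; omega), getD_twoString hr,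
      hxi] at h1
    have hsucc : (i + 1) % (a + b + 2)
        = if i % (a + b + 2) = a + b + 1 then 0 else i % (a + b + 2) + 1 := by
      rw [Nat.add_mod, Nat.mod_eq_of_lt (show 1 < a + b + 2 by omega)]
      split_ifs with h
      · rw [h]; exact Nat.mod_self _
      · exact Nat.mod_eq_of_lt (by omega)
    rw [hsucc]
    generalize i % (a + b + 2) = r at *
    cases hx : x (i + 1) <;> simp only [hx, decide_eq_true_eq] at h1 <;> symm <;>
      simp only [decide_eq_false_iff_not, decide_eq_true_eq] <;>
      split_ifs at h1 ⊢ <;> first | omega | contradiction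

lemma FollowsPattern.eq_of_load_one {K : ℕ} {T : Assignment K} {x : ℕ → Bool}
    (hT : FollowsPattern T x) (hload : load T = stringLoad [1] K) : ∀ i < K, x i = false := by
  intro i
  induction i with
  | zero => exact fun _ => hT.1
  | succ i ih =>
    intro hi
    have h1 := hT.load_eq (i := i) hi
    have h2 : stringLoad [1] K ⟨i, by omega⟩ = 1 := by
      simp [stringLoad, Nat.mod_one]
    rw [hload, h2, ih (by omega)] at h1
    cases hx : x (i + 1)
    · rfl
    · simp [hx] at h1

/-! ### Asymptotics of the average degrees of freedom -/

lemma avgDof_nonneg {ν : Measure ℂ} [IsProbabilityMeasure ν]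
    [NullSingletonClass ν] (hν : Integrable (fun h : ℂ => Real.log (1 + ‖h‖ ^ 2)) ν)
    {p : ℝ} (hp0 : 0 ≤ p) (hp1 : p ≤ 1) {K : ℕ} (T : Assignment K) : 0 ≤ avgDof ν p T :=
  Finset.sum_nonneg fun ω _ => by
    rw [dof_eq_maxActive hν]
    exact mul_nonneg (Topology.prob_nonneg hp0 hp1 ω) (Nat.cast_nonneg _)

lemma avgDof_le_of_irreducible {ν : Measure ℂ} [IsProbabilityMeasure ν]
    [NullSingletonClass ν] (hν : Integrable (fun h : ℂ => Real.log (1 + ‖h‖ ^ 2)) ν)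
    {p : ℝ} (hp0 : 0 ≤ p) (hp1 : p ≤ 1) {K : ℕ} {T : Assignment K} (hT : Irreducible T) :
    avgDof ν p T ≤ K * bestRate (1 - p) + 1 := by
  obtain ⟨x, hx⟩ := hT.exists_pattern
  rw [avgDof_eq_sum_greedyProb hν p hx]
  exact sum_greedyProb_le (by linarith) (by linarith) hx.1 K

/-- Messages that can never be sent can be reassigned to their own transmitters. -/
lemma exists_irreducible_avgDof_le {ν : Measure ℂ} [IsProbabilityMeasure ν]
    [NullSingletonClass ν] (hν : Integrable (fun h : ℂ => Real.log (1 + ‖h‖ ^ 2)) ν)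
    {p : ℝ} (hp0 : 0 ≤ p) (hp1 : p ≤ 1) {K : ℕ} {T : Assignment K} (hT : ∀ i, (T i).card ≤ 1) :
    ∃ T' : Assignment K, Irreducible T' ∧ avgDof ν p T ≤ avgDof ν p T' := by
  classical
  set T' : Assignment K := fun i =>
    if ∃ j : Fin K, T i = {j} ∧ (i = j ∨ (i : ℕ) = (j : ℕ) + 1) then T i else {i} with hT'
  refine ⟨T', fun i => ?_, Finset.sum_le_sum fun ω _ => ?_⟩
  · simp only [T']
    split_ifs with h
    · exact h
    · exact ⟨i, rfl, Or.inl rfl⟩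
  · rw [dof_eq_maxActive hν, dof_eq_maxActive hν]
    refine mul_le_mul_of_nonneg_left ?_ (Topology.prob_nonneg hp0 hp1 ω)
    refine Nat.cast_le.2 (maxActive_le fun A hA => Feasible.card_le
      ⟨fun a ha => ?_, hA.linked, hA.orthogonal⟩)
    have h1 := hA.known a ha
    -- A message in a feasible set has a linked transmitter as its only one, so `T'` leaves it
    -- unchanged.
    have h2 : T a.1 = {a.2} :=
      Finset.eq_singleton_iff_unique_mem.2 ⟨h1, fun y hy => Finset.card_le_one.1 (hT _) y hy _ h1⟩
    obtain ⟨h3, -⟩ := hA.linked a ha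
    simp only [T']
    rw [if_pos ⟨a.2, h2, h3⟩]
    exact h1

lemma bestDof_le {ν : Measure ℂ} [IsProbabilityMeasure ν]
    [NullSingletonClass ν] (hν : Integrable (fun h : ℂ => Real.log (1 + ‖h‖ ^ 2)) ν)
    {p : ℝ} (hp0 : 0 ≤ p) (hp1 : p ≤ 1) (K : ℕ) :
    bestDof ν p K 1 ≤ K * bestRate (1 - p) + 1 := by
  have : Nonempty {T : Assignment K // ∀ i, (T i).card ≤ 1} := ⟨⟨fun _ => ∅, by simp⟩⟩
  refine ciSup_le fun T => ?_
  obtain ⟨T', hT', hle⟩ := exists_irreducible_avgDof_le hν hp0 hp1 T.2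
  exact hle.trans (avgDof_le_of_irreducible hν hp0 hp1 hT')

lemma avgDof_patternAssignment_le (ν : Measure ℂ) (p : ℝ) (x : ℕ → Bool) (K : ℕ) :
    avgDof ν p (patternAssignment x K) ≤ bestDof ν p K 1 :=
  le_ciSup (f := fun T : {T : Assignment K // ∀ i, (T i).card ≤ 1} => avgDof ν p T.1)
    (Set.finite_range _).bddAbove ⟨patternAssignment x K, by simp [patternAssignment]⟩

lemma tendsto_upper (c : ℝ) :
    Tendsto (fun K : ℕ => ((K : ℝ) * c + 1) / (K : ℝ)) atTop (𝓝 c) := by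
  have h := (tendsto_const_nhds (x := c)).add (tendsto_const_div_atTop_nhds_zero_nat (1 : ℝ))
  rw [add_zero] at h
  refine h.congr' ?_
  filter_upwards [eventually_gt_atTop 0] with K hK
  have : (K : ℝ) ≠ 0 := by positivity
  field_simp

lemma tendsto_avgDof_periodic {ν : Measure ℂ} [IsProbabilityMeasure ν]
    [NullSingletonClass ν] (hν : Integrable (fun h : ℂ => Real.log (1 + ‖h‖ ^ 2)) ν)
    {p : ℝ} (hp0 : 0 ≤ p) (hp1 : p ≤ 1) {a b : ℕ} (ha : 1 ≤ a) (hb : 1 ≤ b) :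
    Tendsto (fun K : ℕ => avgDof ν p
        (patternAssignment (fun i => decide (a ≤ i % (a + b))) K) / (K : ℝ)) atTop
      (𝓝 (segmentValue (1 - p) a b / (a + b))) := by
  have h := tendsto_sum_greedyProb_periodic (q := 1 - p) (by linarith) (by linarith) ha hb
    (x := fun _ i => decide (a ≤ i % (a + b))) (fun _ _ _ => rfl)
  refine h.congr fun K => ?_
  rw [avgDof_eq_sum_greedyProb hν p (followsPattern_patternAssignment (by simp; omega) K)]

lemma tendsto_avgDof_const {ν : Measure ℂ} [IsProbabilityMeasure ν]
    [NullSingletonClass ν] (hν : Integrable (fun h : ℂ => Real.log (1 + ‖h‖ ^ 2)) ν)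
    {p : ℝ} (hp0 : 0 ≤ p) (hp1 : p ≤ 1) {T : ∀ K : ℕ, Assignment K} {x : ℕ → ℕ → Bool}
    (hT : ∀ K, FollowsPattern (T K) (x K)) (hx : ∀ K, ∀ i < K, x K i = false) :
    Tendsto (fun K : ℕ => avgDof ν p (T K) / (K : ℝ)) atTop (𝓝 (tau1 p)) := by
  rw [tau1_eq hp0 hp1]
  refine (tendsto_segmentValue_zero_right (q := 1 - p) (by linarith) (by linarith)).congr
    fun K => ?_
  rw [avgDof_eq_sum_greedyProb hν p (hT K), sum_greedyProb_const K (hx K)]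

lemma tendsto_bestDof_div {ν : Measure ℂ} [IsProbabilityMeasure ν]
    [NullSingletonClass ν] (hν : Integrable (fun h : ℂ => Real.log (1 + ‖h‖ ^ 2)) ν)
    {p : ℝ} (hp0 : 0 ≤ p) (hp1 : p ≤ 1) :
    Tendsto (fun K : ℕ => bestDof ν p K 1 / (K : ℝ)) atTop
      (𝓝 (max (max (tau1 p) (tau2 p)) (tau3 p))) := by
  have h1 := tendsto_avgDof_const hν hp0 hp1
    (fun K => followsPattern_patternAssignment (x := fun _ => false) rfl K) (fun _ _ _ => rfl)
  have h2 := tendsto_avgDof_periodic hν hp0 hp1 (a := 1) (b := 2) (by norm_num) (by norm_num)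
  have h3 := tendsto_avgDof_periodic hν hp0 hp1 (a := 2) (b := 2) (by norm_num) (by norm_num)
  have e2 : segmentValue (1 - p) 1 2 / ((1 : ℕ) + (2 : ℕ) : ℝ) = tau2 p := by
    rw [tau2_eq]; norm_num
  have e3 : segmentValue (1 - p) 2 2 / ((2 : ℕ) + (2 : ℕ) : ℝ) = tau3 p := by
    rw [tau3_eq]; norm_num
  rw [e2] at h2
  rw [e3] at h3
  have hup := tendsto_upper (bestRate (1 - p))
  rw [bestRate_eq hp0 hp1] at hup
  refine tendsto_of_tendsto_of_tendsto_of_le_of_le ((h1.max h2).max h3) hup ?_ ?_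
  · intro K
    have hK : (0 : ℝ) ≤ K := Nat.cast_nonneg K
    refine max_le (max_le ?_ ?_) ?_ <;>
      exact div_le_div_of_nonneg_right (avgDof_patternAssignment_le _ _ _ _) hK
  · intro K
    have h := bestDof_le hν hp0 hp1 K
    rw [bestRate_eq hp0 hp1] at h
    exact div_le_div_of_nonneg_right h (Nat.cast_nonneg K)

lemma limsup_avgDof_le {ν : Measure ℂ} [IsProbabilityMeasure ν]
    [NullSingletonClass ν] (hν : Integrable (fun h : ℂ => Real.log (1 + ‖h‖ ^ 2)) ν)
    {p : ℝ} (hp0 : 0 ≤ p) (hp1 : p ≤ 1) {T : ∀ K : ℕ, Assignment K}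
    (hT : ∀ K, Irreducible (T K)) :
    limsup (fun K : ℕ => avgDof ν p (T K) / (K : ℝ)) atTop ≤ bestRate (1 - p) := by
  have hup := tendsto_upper (bestRate (1 - p))
  rw [← hup.limsup_eq]
  refine limsup_le_limsup (Eventually.of_forall fun K => ?_) ?_ hup.isBoundedUnder_le
  · exact div_le_div_of_nonneg_right (avgDof_le_of_irreducible hν hp0 hp1 (hT K))
      (Nat.cast_nonneg K)
  · exact IsCoboundedUnder.of_frequently_ge (a := 0) (Frequently.of_forall fun K =>
      div_nonneg (avgDof_nonneg hν hp0 hp1 _) (Nat.cast_nonneg K))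

lemma tendsto_avgDof_twoString {ν : Measure ℂ} [IsProbabilityMeasure ν]
    [NullSingletonClass ν] (hν : Integrable (fun h : ℂ => Real.log (1 + ‖h‖ ^ 2)) ν)
    {p : ℝ} (hp0 : 0 ≤ p) (hp1 : p ≤ 1) {a b : ℕ} {T : ∀ K : ℕ, Assignment K}
    (hT : DefinedBy T (twoString a b)) :
    Tendsto (fun K : ℕ => avgDof ν p (T K) / (K : ℝ)) atTop
      (𝓝 (segmentValue (1 - p) (a + 1) (b + 1) / ((a + 1 : ℕ) + (b + 1 : ℕ)))) := by
  choose x hx using fun K => (hT K).1.exists_pattern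
  have h := tendsto_sum_greedyProb_periodic (q := 1 - p) (by linarith) (by linarith)
    (Nat.le_add_left 1 a) (Nat.le_add_left 1 b)
    (fun K => (hx K).eq_of_load_twoString (hT K).2)
  refine h.congr fun K => ?_
  rw [avgDof_eq_sum_greedyProb hν p (hx K)]

lemma segmentValue_one_le {p : ℝ} (hp0 : 0 ≤ p) (hp1 : p ≤ 1) (n : ℕ) :
    segmentValue (1 - p) 1 (n + 1) / ((1 : ℕ) + (n + 1 : ℕ))
      ≤ ((n : ℝ) - 1) / ((n : ℝ) + 2) * tau1 p + 3 / ((n : ℝ) + 2) * tau2 p := by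
  have hq0 : 0 ≤ 1 - p := by linarith
  have hn : (0 : ℝ) < (n : ℝ) + 2 := by positivity
  have hg := segmentGain_one_le hq0 (by linarith : 1 - p ≤ 1) (Nat.le_add_left 1 n)
  have h := mul_le_mul_of_nonneg_left hg (mul_nonneg (chainRate_nonneg hq0) hq0)
  rw [tau1_eq hp0 hp1, tau2_eq]
  rw [div_mul_eq_mul_div, div_mul_eq_mul_div, ← add_div]
  rw [show (((1 : ℕ) : ℝ) + ((n + 1 : ℕ) : ℝ)) = n + 2 by push_cast; ring]
  gcongr
  simp only [segmentValue]
  push_cast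
  linarith

lemma segmentValue_one_even_le {p : ℝ} (hp0 : 0 ≤ p) (hp1 : p ≤ 1) {n : ℕ} (hn : Even n) :
    segmentValue (1 - p) 1 (n + 1) / ((1 : ℕ) + (n + 1 : ℕ))
      ≤ (n : ℝ) / ((n : ℝ) + 2) * tau1 p + 2 / ((n : ℝ) + 2) * tau2 p := by
  have hq0 : 0 ≤ 1 - p := by linarith
  have hn2 : (0 : ℝ) < (n : ℝ) + 2 := by positivity
  have hg := segmentGain_one_odd_le (by linarith : 1 - p ≤ 1) hn.add_one
  have h := mul_le_mul_of_nonneg_left hg (mul_nonneg (chainRate_nonneg hq0) hq0)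
  rw [tau1_eq hp0 hp1, tau2_eq]
  rw [div_mul_eq_mul_div, div_mul_eq_mul_div, ← add_div]
  rw [show (((1 : ℕ) : ℝ) + ((n + 1 : ℕ) : ℝ)) = n + 2 by push_cast; ring]
  gcongr
  simp only [segmentValue]
  push_cast
  linarith

end WynerTDMA

end

theorem theorem1 (ν : Measure ℂ) [IsProbabilityMeasure ν] [NullSingletonClass ν]
    (hν : Integrable (fun h : ℂ => Real.log (1 + ‖h‖ ^ 2)) ν)
    (p : ℝ) (hp0 : 0 ≤ p) (hp1 : p ≤ 1) :
    -- the average per-user DoF for single-transmitter assignments and orthogonal TDMA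
    Tendsto (fun K : ℕ => WynerTDMA.bestDof ν p K 1 / (K : ℝ)) atTop
      (𝓝 (max (max (WynerTDMA.tau1 p) (WynerTDMA.tau2 p)) (WynerTDMA.tau3 p))) ∧
    -- every irreducible single-transmitter strategy
    (∀ T : ∀ K : ℕ, WynerTDMA.Assignment K, (∀ K, WynerTDMA.Irreducible (T K)) →
      WynerTDMA.BoundedByConvexComb p
        (limsup (fun K : ℕ => WynerTDMA.avgDof ν p (T K) / (K : ℝ)) atTop)) ∧
    -- the string (1)
    (∀ T : ∀ K : ℕ, WynerTDMA.Assignment K, WynerTDMA.DefinedBy T [1] →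
      Tendsto (fun K : ℕ => WynerTDMA.avgDof ν p (T K) / (K : ℝ)) atTop
        (𝓝 (WynerTDMA.tau1 p))) ∧
    -- the strings (2, 1, ..., 1, 0) and (1, ..., 1, 2, 0) with n ones
    (∀ (n : ℕ) (T : ∀ K : ℕ, WynerTDMA.Assignment K),
      WynerTDMA.DefinedBy T (WynerTDMA.twoString 0 n) ∨
        WynerTDMA.DefinedBy T (WynerTDMA.twoString n 0) →
      ∃ L : ℝ, Tendsto (fun K : ℕ => WynerTDMA.avgDof ν p (T K) / (K : ℝ)) atTop (𝓝 L) ∧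
        (Odd n → L ≤ ((n : ℝ) - 1) / ((n : ℝ) + 2) * WynerTDMA.tau1 p
          + 3 / ((n : ℝ) + 2) * WynerTDMA.tau2 p) ∧
        (Even n → L ≤ (n : ℝ) / ((n : ℝ) + 2) * WynerTDMA.tau1 p
          + 2 / ((n : ℝ) + 2) * WynerTDMA.tau2 p)) ∧
    -- the strings (1, ..., 1, 2, 1, ..., 1, 0)
    (∀ (a b : ℕ), 1 ≤ a → 1 ≤ b → ∀ T : ∀ K : ℕ, WynerTDMA.Assignment K,
      WynerTDMA.DefinedBy T (WynerTDMA.twoString a b) →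
      ∃ L : ℝ, Tendsto (fun K : ℕ => WynerTDMA.avgDof ν p (T K) / (K : ℝ)) atTop (𝓝 L) ∧
        WynerTDMA.BoundedByConvexComb p L) := by
  refine ⟨WynerTDMA.tendsto_bestDof_div hν hp0 hp1, ?_, ?_, ?_, ?_⟩
  · intro T hT
    refine WynerTDMA.boundedByConvexComb_of_le_max ?_
    rw [← WynerTDMA.bestRate_eq hp0 hp1]
    exact WynerTDMA.limsup_avgDof_le hν hp0 hp1 hT
  · intro T hT
    choose x hx using fun K => (hT K).1.exists_pattern
    exact WynerTDMA.tendsto_avgDof_const hν hp0 hp1 hx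
      fun K => (hx K).eq_of_load_one (hT K).2
  · intro n T hT
    refine ⟨_, ?_, fun _ => WynerTDMA.segmentValue_one_le hp0 hp1 n,
      fun hn => WynerTDMA.segmentValue_one_even_le hp0 hp1 hn⟩
    rcases hT with hT | hT
    · exact WynerTDMA.tendsto_avgDof_twoString hν hp0 hp1 hT
    · have h := WynerTDMA.tendsto_avgDof_twoString hν hp0 hp1 hT
      -- The two strings give mirror-image segments of equal value.
      rwa [WynerTDMA.segmentValue_comm, add_comm ((n + 1 : ℕ) : ℝ)] at h
  · intro a b _ _ T hT
    have h := WynerTDMA.tendsto_avgDof_twoString hν hp0 hp1 hT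
    refine ⟨_, h, WynerTDMA.boundedByConvexComb_of_le_max ?_⟩
    rw [← WynerTDMA.bestRate_eq hp0 hp1, ← h.limsup_eq]
    exact WynerTDMA.limsup_avgDof_le hν hp0 hp1 fun K => (hT K).1
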